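/- A Schröder prefix of length $n$ is a lattice path of total length $n$, starting at the origin, made of up steps (length $1$, height change $+1$), down steps (length $1$, height change $-1$) and horizontal steps (length $2$, height change $0$), whose height never becomes negative. Put $\rho=\sqrt2-1$, so that $\rho+\rho+\rho^2=1$. For a target length $n$, the anticipated rejection sampler builds a path from independent random steps, each of them up, down or horizontal with respective probabilities $\rho,\rho,\rho^2$. As soon as the path goes below height $0$, or its length jumps from $n-1$ to $n+1$, the path is discarded and the construction restarts from the empty path; the sampler stops as soon as the path under construction has length exactly $n$. Let $Y_n$ be the total length of all the steps drawn, in the failed attempts (including the step that causes the rejection) and in the successful one. For $0<\alpha<1$ let $$\phi_\alpha(s)=\Bigl(1-\sum_{m\ge1}\frac{\alpha}{m-\alpha}\,\frac{(is)^m}{m!}\Bigr)^{-1}$$ be the characteristic function of the Darling–Mandelbrot law of parameter $\alpha$, let $\mathcal D(\alpha)$ be the shifted law, with characteristic function $e^{is}\phi_\alpha(s)$, and for $0<p\le1$ let $\mathcal D(\alpha,p)$ be its geometric convolution, that is, the law of $W_1+\dots+W_Z$ with $W_1,W_2,\dots$ independent of law $\mathcal D(\alpha)$ and $Z$ independent of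 them with $\mathbb P(Z=k)=(1-p)^{k-1}p$ for $k\ge1$. **Proposition.** For every $n\ge0$ the sampler stops almost surely and $Y_n$ is integrable. The probability law $\mathcal D\bigl(\tfrac12,\tfrac{2+\sqrt2}4\bigr)$ exists and, as $n\to\infty$, $Y_n/n$ converges in distribution to it. Moreover $\mathbb E(Y_n)\sim(8-4\sqrt2)\,n$. -/

import Mathlib

open MeasureTheory ProbabilityTheory Filter Asymptotics

/-- The three steps of a Schröder path. -/
inductive SchroderStep where
  | up
  | down
  | flat

namespace SchroderStep

instance : MeasurableSpace SchroderStep := ⊤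

/-- Length of a step: the horizontal step has length `2`, the two others have length `1`. -/
def length : SchroderStep → ℕ
  | up => 1
  | down => 1
  | flat => 2

/-- Height increment of a step. -/
def rise : SchroderStep → ℤ
  | up => 1
  | down => -1
  | flat => 0

/-- The constant `ρ = √2 - 1`. -/
noncomputable def rho : ℝ := √2 - 1

/-- Probability with which the sampler draws a step: `ρ`, `ρ`, `ρ²`. -/
noncomputable def weight : SchroderStep → ℝ
  | up => rho
  | down => rho
  | flat => rho ^ 2

end SchroderStep

namespace SchroderSampler

/-- One step of the sampler with target length `n`. The state is the pair (length, final height)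
of the path under construction. The drawn step is appended to the path; if the new path goes below
the origin or is longer than `n` (a jump from `n - 1` to `n + 1`), it is discarded and the
construction restarts from the empty path. -/
def advance (n : ℕ) (st : ℕ × ℤ) (s : SchroderStep) : ℕ × ℤ :=
  if st.2 + s.rise < 0 ∨ n < st.1 + s.length then (0, 0)
  else (st.1 + s.length, st.2 + s.rise)

/-- State after `k` draws, when the successive drawn steps are `x 0, x 1, …`. -/
def state (n : ℕ) (x : ℕ → SchroderStep) : ℕ → ℕ × ℤ
  | 0 => (0, 0)
  | k + 1 => advance n (state n x k) (x k)

/-- The sampler stops: at some time the path under construction has length exactly `n`. -/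
def Halts (n : ℕ) (x : ℕ → SchroderStep) : Prop :=
  ∃ k, (state n x k).1 = n

/-- Number of steps drawn until the path under construction first has length `n`
(relevant only when the sampler stops). -/
noncomputable def haltTime (n : ℕ) (x : ℕ → SchroderStep) : ℕ :=
  sInf {k | (state n x k).1 = n}

/-- Total length of all the steps drawn, in the failed attempts and in the successful one. -/
noncomputable def drawnLength (n : ℕ) (x : ℕ → SchroderStep) : ℕ :=
  ∑ k ∈ Finset.range (haltTime n x), (x k).length

end SchroderSampler

/-- The characteristic function
`φ_α(s) = (1 - ∑_{n ≥ 1} α / (n - α) * (i s)ⁿ / n!)⁻¹`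
of the Darling–Mandelbrot law of parameter `α`, for `0 < α < 1`. -/
noncomputable def darlingMandelbrotCharFun (α s : ℝ) : ℂ :=
  (1 - ∑' m : ℕ, (α : ℂ) / ((m + 1 : ℂ) - α) *
    (Complex.I * s) ^ (m + 1) / ((m + 1).factorial : ℂ))⁻¹

/-- `ν` is the law `𝒟(α)`: the Darling–Mandelbrot law shifted by one, i.e. the probability measure
with characteristic function `e^{is} φ_α(s)`. -/
structure IsShiftedDarlingMandelbrot (α : ℝ) (ν : Measure ℝ) : Prop where
  isProbabilityMeasure : IsProbabilityMeasure ν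
  charFun_eq : ∀ s : ℝ, charFun ν s = Complex.exp (Complex.I * s) * darlingMandelbrotCharFun α s

/-- The `k`-fold convolution power of a measure: the law of the sum of `k` independent variables
of law `ν`. -/
noncomputable def convPower (ν : Measure ℝ) : ℕ → Measure ℝ
  | 0 => Measure.dirac 0
  | k + 1 => Measure.conv (convPower ν k) ν

/-- The geometric convolution of `ν`: the law of `W₁ + ⋯ + W_Z`, where the `Wᵢ` are independent of
law `ν` and `Z ≥ 1` is independent of them and geometric, `P(Z = k + 1) = (1 - p)ᵏ p`. -/
noncomputable def geometricConvolution (p : ℝ) (ν : Measure ℝ) : Measure ℝ :=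
  Measure.sum fun k : ℕ => ENNReal.ofReal ((1 - p) ^ k * p) • convPower ν (k + 1)

/-- `L` is the law `𝒟(α, p)`: the geometric convolution with parameter `p` of `𝒟(α)`. -/
def IsGeometricDarlingMandelbrot (α p : ℝ) (L : Measure ℝ) : Prop :=
  ∃ ν : Measure ℝ, IsShiftedDarlingMandelbrot α ν ∧ L = geometricConvolution p ν

/-!
Only the probability `q < 1` of a flat step matters, the remaining mass being shared equally by the
up and down steps. Let `f m` be the probability that a path is first below `0` at length `m` and
`s n` the probability that it reaches length `n` before that. The generating function of `s` is
explicit, with an algebraic singularity `(1 - z) ^ (-1/2)`, so that `s n ~ A / √n`. A path that is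
first below `0` after length `n + 1` either has reached that length or has jumped over it from `n`:
hence `∑_{m > n + 1} f m = s (n + 1) + q s n ~ (1 + q) A / √n`.

The attempts of the sampler are independent. Therefore `E (z ^ Y n) = s n zⁿ / (1 - F n z)`, where
`F n z` is the generating function of the length of a failed attempt: `f m` for `m ≤ n`, and the
remaining mass `∑_{m > n} f m - s n` at `n + 1`. With `z = exp (i t / n)` and both terms scaled
by `√n`, Abel summation against the tail of `f` gives the limit
`(1 + q) A (exp (i t) - ∫₀¹ x ^ (-1/2) i t exp (i t x) dx) = (1 + q) A φ_{1/2}(t)⁻¹` for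
`1 - ∑_{m ≤ n} f m z ^ m`. The quotient converges to the characteristic function of `𝒟 (1/2, p)`
with `p = lim s n / ∑_{m > n} f m = (1 + q)⁻¹`, and the mean is treated the same way.

The Darling–Mandelbrot law itself is the limit, given by Lévy's continuity theorem, of a similar
scheme: when `ℙ (X > x) ~ x ^ (-α)`, sum independent copies of `X / n`, with the values beyond `1`
replaced by `0`, up to an independent geometric time of parameter `ℙ (X > n)`.
-/

open Topology

/-! ### Regularly varying sequences -/

theorem tendsto_rpow_mul_comp {a A L : ℝ} {u : ℕ → ℝ} {k : ℕ → ℕ}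
    (hu : Tendsto (fun n : ℕ => (n : ℝ) ^ a * u n) atTop (𝓝 A)) (hL : 0 < L)
    (hk : Tendsto (fun n : ℕ => (k n : ℝ) / n) atTop (𝓝 L)) :
    Tendsto (fun n : ℕ => (n : ℝ) ^ a * u (k n)) atTop (𝓝 (L ^ (-a) * A)) := by
  have hk_atTop : Tendsto k atTop atTop := by
    rw [← tendsto_natCast_atTop_iff (R := ℝ)]
    refine (hk.pos_mul_atTop hL tendsto_natCast_atTop_atTop).congr' ?_
    filter_upwards [eventually_ne_atTop 0] with n hn
    exact div_mul_cancel₀ _ (Nat.cast_ne_zero.2 hn)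
  refine ((hk.rpow_const (p := -a) (Or.inl hL.ne')).mul (hu.comp hk_atTop)).congr' ?_
  filter_upwards [eventually_gt_atTop 0, hk_atTop.eventually_gt_atTop 0] with n hn hkn
  have hn' : (0 : ℝ) < n := Nat.cast_pos.2 hn
  have hkn' : (0 : ℝ) < k n := Nat.cast_pos.2 hkn
  rw [Function.comp_apply, ← mul_assoc, Real.rpow_neg (by positivity),
    Real.div_rpow hkn'.le hn'.le, inv_div, div_mul_cancel₀ _ (by positivity)]

theorem tendsto_natCast_sub_div_atTop (j : ℕ) :
    Tendsto (fun n : ℕ => ((n - j : ℕ) : ℝ) / n) atTop (𝓝 1) := by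
  have h : Tendsto (fun n : ℕ => 1 - (j : ℝ) / n) atTop (𝓝 (1 - 0)) :=
    (tendsto_const_div_atTop_nhds_zero_nat (j : ℝ)).const_sub 1
  rw [sub_zero] at h
  refine h.congr' ?_
  filter_upwards [eventually_gt_atTop 0, eventually_ge_atTop j] with n hn hj
  have hn' : (0 : ℝ) < n := Nat.cast_pos.2 hn
  rw [Nat.cast_sub hj, sub_div, div_self hn'.ne']

theorem tendsto_natCast_add_div_atTop (j : ℕ) :
    Tendsto (fun n : ℕ => ((n + j : ℕ) : ℝ) / n) atTop (𝓝 1) := by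
  have h : Tendsto (fun n : ℕ => 1 + (j : ℝ) / n) atTop (𝓝 (1 + 0)) :=
    (tendsto_const_div_atTop_nhds_zero_nat (j : ℝ)).const_add 1
  rw [add_zero] at h
  refine h.congr' ?_
  filter_upwards [eventually_gt_atTop 0] with n hn
  have hn' : (0 : ℝ) < n := Nat.cast_pos.2 hn
  rw [Nat.cast_add, add_div, div_self hn'.ne']

theorem exists_add_one_rpow_mul_abs_le {a A : ℝ} {u : ℕ → ℝ}
    (hu : Tendsto (fun n : ℕ => (n : ℝ) ^ a * u n) atTop (𝓝 A)) :
    ∃ M, ∀ n : ℕ, ((n : ℝ) + 1) ^ a * |u n| ≤ M := by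
  have h : Tendsto (fun n : ℕ => ((n + 1 : ℕ) : ℝ) ^ a * u n) atTop (𝓝 A) := by
    refine (tendsto_add_atTop_iff_nat (f := fun n : ℕ => (n : ℝ) ^ a * u (n - 1)) 1).2 ?_
    simpa using tendsto_rpow_mul_comp hu one_pos (tendsto_natCast_sub_div_atTop 1)
  obtain ⟨M, hM⟩ := h.abs.bddAbove_range
  refine ⟨M, fun n => ?_⟩
  have hn : |((n + 1 : ℕ) : ℝ) ^ a * u n| ≤ M := hM ⟨n, rfl⟩
  rwa [abs_mul, abs_of_nonneg (by positivity), Nat.cast_add_one] at hn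

theorem tendsto_rpow_mul_convolution {a A : ℝ} {u b : ℕ → ℝ} (ha : 0 ≤ a)
    (hu : Tendsto (fun n : ℕ => (n : ℝ) ^ a * u n) atTop (𝓝 A))
    (hb : Summable fun j : ℕ => ((j : ℝ) + 1) ^ a * |b j|) :
    Tendsto (fun n : ℕ => (n : ℝ) ^ a *
      ∑ ij ∈ Finset.HasAntidiagonal.antidiagonal n, u ij.1 * b ij.2) atTop
      (𝓝 (A * ∑' j, b j)) := by
  obtain ⟨M, hM⟩ := exists_add_one_rpow_mul_abs_le hu
  have hterm (j : ℕ) : Tendsto (fun n : ℕ => if j ≤ n then (n : ℝ) ^ a * (u (n - j) * b j) else 0)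
      atTop (𝓝 (A * b j)) := by
    have h := (tendsto_rpow_mul_comp hu one_pos (tendsto_natCast_sub_div_atTop j)).mul_const (b j)
    rw [Real.one_rpow, one_mul] at h
    refine h.congr' ?_
    filter_upwards [eventually_ge_atTop j] with n hn
    rw [if_pos hn, mul_assoc]
  have hbound (n j : ℕ) : ‖if j ≤ n then (n : ℝ) ^ a * (u (n - j) * b j) else 0‖ ≤
      M * (((j : ℝ) + 1) ^ a * |b j|) := by
    split_ifs with hj
    · have hn : (n : ℝ) ≤ ((n - j : ℕ) + 1) * (j + 1) := by
        rw [Nat.cast_sub hj]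
        nlinarith [mul_nonneg (sub_nonneg.2 (Nat.cast_le (α := ℝ).2 hj)) (Nat.cast_nonneg j)]
      calc ‖(n : ℝ) ^ a * (u (n - j) * b j)‖ = (n : ℝ) ^ a * (|u (n - j)| * |b j|) := by
            rw [norm_mul, norm_mul, Real.norm_of_nonneg (by positivity), Real.norm_eq_abs,
              Real.norm_eq_abs]
        _ ≤ (((n - j : ℕ) + 1) * (j + 1) : ℝ) ^ a * (|u (n - j)| * |b j|) := by gcongr
        _ = (((n - j : ℕ) + 1 : ℝ) ^ a * |u (n - j)|) * (((j : ℝ) + 1) ^ a * |b j|) := by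
            rw [Real.mul_rpow (by positivity) (by positivity)]
            ring
        _ ≤ M * (((j : ℝ) + 1) ^ a * |b j|) := by gcongr; exact hM _
    · rw [norm_zero]
      exact mul_nonneg ((hM 0).trans' (by positivity)) (by positivity)
  rw [← tsum_mul_left]
  refine (tendsto_tsum_of_dominated_convergence (hb.mul_left M) hterm
    (Eventually.of_forall hbound)).congr fun n => ?_
  rw [Finset.Nat.antidiagonal_eq_map', Finset.sum_map, Finset.mul_sum,
    tsum_eq_sum (s := Finset.range (n + 1))
      fun j hj => if_neg (by simpa [Nat.lt_succ_iff] using hj)]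
  exact Finset.sum_congr rfl fun j hj => if_pos (Finset.mem_range_succ_iff.1 hj)

theorem centralBinom_div_four_pow_eq_sqrt_wallis (n : ℕ) :
    (n.centralBinom : ℝ) / 4 ^ n = √(1 / ((2 * n + 1) * Real.Wallis.W n)) := by
  have hpow : (2 : ℝ) ^ (4 * n) = (4 ^ n) ^ 2 := by
    rw [← pow_mul, mul_comm n, pow_mul, pow_mul]
    norm_num
  rw [eq_comm, Real.sqrt_eq_iff_mul_self_eq (by have := Real.Wallis.W_pos n; positivity)
    (by positivity), Real.Wallis.W_eq_factorial_ratio, Nat.centralBinom_eq_two_mul_choose,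
    hpow, two_mul n, Nat.cast_add_choose]
  field_simp

theorem tendsto_rpow_half_mul_centralBinom :
    Tendsto (fun n : ℕ => (n : ℝ) ^ (1 / 2 : ℝ) * ((n.centralBinom : ℝ) / 4 ^ n)) atTop
      (𝓝 (√(1 / Real.pi))) := by
  have h : Tendsto (fun n : ℕ => ((2 + 1 / (n : ℝ)) * Real.Wallis.W n)⁻¹) atTop
      (𝓝 (((2 + 0) * (Real.pi / 2))⁻¹)) :=
    ((tendsto_one_div_atTop_nhds_zero_nat.const_add 2).mul
      Real.Wallis.tendsto_W_nhds_pi_div_two).inv₀ (by positivity)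
  rw [show ((2 + 0) * (Real.pi / 2))⁻¹ = 1 / Real.pi by field_simp; ring] at h
  refine h.sqrt.congr' ?_
  filter_upwards [eventually_gt_atTop 0] with n hn
  have hn' : (0 : ℝ) < n := Nat.cast_pos.2 hn
  rw [centralBinom_div_four_pow_eq_sqrt_wallis, ← Real.sqrt_eq_rpow, ← Real.sqrt_mul hn'.le]
  congr 1
  have := Real.Wallis.W_pos n
  field_simp

/-! ### Truncated and restarted attempts -/

open Finset in
/-- The mass that a law `f` on `ℕ` gives to `{n + 1, n + 2, …}`. -/
noncomputable def tailMass (f : ℕ → ℝ) (n : ℕ) : ℝ := 1 - ∑ m ∈ range (n + 1), f m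

open Finset in
/-- The generating function of the length of a failed attempt with target `n`: the attempt fails at
length `m ≤ n` with probability `f m`, and otherwise overshoots to `n + 1` unless it succeeds, with
probability `s n`. -/
noncomputable def failGenFun (f s : ℕ → ℝ) (n : ℕ) (z : ℂ) : ℂ :=
  ∑ m ∈ range (n + 1), (f m : ℂ) * z ^ m + ((tailMass f n - s n : ℝ) : ℂ) * z ^ (n + 1)

/-- The generating function of the total length of the independent attempts with target `n` up to
the first success. -/
noncomputable def restartGenFun (f s : ℕ → ℝ) (n : ℕ) (z : ℂ) : ℂ :=
  s n * z ^ n / (1 - failGenFun f s n z)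

open Finset in
/-- The expected total length of the independent attempts with target `n` up to the first
success. -/
noncomputable def restartMean (f s : ℕ → ℝ) (n : ℕ) : ℝ :=
  (∑ m ∈ range (n + 1), f m * m + (tailMass f n - s n) * (n + 1) + s n * n) / s n

section Restart

variable {f s : ℕ → ℝ} {n : ℕ}

theorem norm_failGenFun_le {z : ℂ} (hf : ∀ m, 0 ≤ f m) (hs : s n ≤ tailMass f n) (hz : ‖z‖ ≤ 1) :
    ‖failGenFun f s n z‖ ≤ 1 - s n := by
  have hterm {c : ℝ} (hc : 0 ≤ c) (m : ℕ) : ‖(c : ℂ) * z ^ m‖ ≤ c := by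
    rw [norm_mul, Complex.norm_real, Real.norm_of_nonneg hc, norm_pow]
    exact mul_le_of_le_one_right hc (pow_le_one₀ (norm_nonneg z) hz)
  calc ‖failGenFun f s n z‖
      ≤ ∑ m ∈ Finset.range (n + 1), f m + (tailMass f n - s n) :=
        (norm_add_le _ _).trans <| add_le_add
          (norm_sum_le_of_le _ fun m _ => hterm (hf m) m) (hterm (sub_nonneg.2 hs) _)
    _ = 1 - s n := by rw [tailMass]; ring

theorem one_sub_failGenFun_ne_zero {z : ℂ} (hf : ∀ m, 0 ≤ f m) (hs0 : 0 < s n)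
    (hs : s n ≤ tailMass f n) (hz : ‖z‖ ≤ 1) : 1 - failGenFun f s n z ≠ 0 := by
  intro h
  have hle := norm_failGenFun_le hf hs hz
  rw [← sub_eq_zero.1 h, norm_one] at hle
  linarith

theorem restartMean_nonneg (hf : ∀ m, 0 ≤ f m) (hs0 : 0 < s n) (hs : s n ≤ tailMass f n) :
    0 ≤ restartMean f s n := by
  have hsum : 0 ≤ ∑ m ∈ Finset.range (n + 1), f m * (m : ℝ) :=
    Finset.sum_nonneg fun m _ => mul_nonneg (hf m) m.cast_nonneg
  have hover : 0 ≤ (tailMass f n - s n) * (n + 1) :=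
    mul_nonneg (sub_nonneg.2 hs) n.cast_add_one_pos.le
  exact div_nonneg (add_nonneg (add_nonneg hsum hover) (mul_nonneg hs0.le n.cast_nonneg)) hs0.le

end Restart

section TailAsymptotics

variable {𝕜 : Type*} [RCLike 𝕜] {h h' : ℝ → 𝕜}

theorem sum_mul_comp_div_eq_integral_tailMass (f : ℕ → ℝ) (hh : ∀ x, HasDerivAt h (h' x) x)
    (hh' : Continuous h') {n : ℕ} (hn : n ≠ 0) :
    ∑ m ∈ Finset.range (n + 1), (f m : 𝕜) * h (m / n) - h 0 =
      (∫ x in (0 : ℝ)..1, (tailMass f ⌊n * x⌋₊ : 𝕜) * h' x) - tailMass f n * h 1 := by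
  have hn' : (n : ℝ) ≠ 0 := Nat.cast_ne_zero.2 hn
  -- Lowering the mass at `0` by `1` turns the partial sums into `-tailMass f`.
  set c : ℕ → 𝕜 := Function.update (fun m => (f m : 𝕜)) 0 (f 0 - 1) with hc
  have hpartial (N : ℕ) : ∑ m ∈ Finset.Icc 0 N, c m = -tailMass f N := by
    rw [← Nat.range_succ_eq_Icc_zero, Finset.sum_range_succ', tailMass, Finset.sum_range_succ']
    simp only [hc, Function.update_self, Function.update_of_ne (Nat.succ_ne_zero _)]
    push_cast
    ring
  have hsum : ∑ m ∈ Finset.Icc 0 n, h (m / n) * c m =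
      ∑ m ∈ Finset.range (n + 1), (f m : 𝕜) * h (m / n) - h 0 := by
    rw [← Nat.range_succ_eq_Icc_zero, Finset.sum_range_succ', Finset.sum_range_succ']
    simp only [hc, Function.update_self, Function.update_of_ne (Nat.succ_ne_zero _),
      Nat.cast_zero, zero_div, mul_comm (h _)]
    ring
  have hderiv (t : ℝ) : HasDerivAt (fun t => h (t / n)) ((n : ℝ)⁻¹ • h' (t / n)) t := by
    rw [← one_div]
    exact (hh (t / n)).scomp t ((hasDerivAt_id' t).div_const (n : ℝ))
  have habel := sum_mul_eq_sub_integral_mul' c n (fun t _ => (hderiv t).differentiableAt) <| by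
    simp only [deriv_eq hderiv]
    exact (by fun_prop : Continuous _).continuousOn.integrableOn_Icc
  simp only [deriv_eq hderiv, hpartial, div_self hn'] at habel
  have hscale : ∫ t in (0 : ℝ)..n, (n : ℝ)⁻¹ • h' (t / n) * -(tailMass f ⌊t⌋₊ : 𝕜) =
      -∫ x in (0 : ℝ)..1, (tailMass f ⌊n * x⌋₊ : 𝕜) * h' x := by
    have h := intervalIntegral.smul_integral_comp_mul_left (a := 0) (b := 1)
      (fun t => (n : ℝ)⁻¹ • h' (t / n) * -(tailMass f ⌊t⌋₊ : 𝕜)) n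
    rw [mul_zero, mul_one] at h
    rw [← h, ← intervalIntegral.integral_smul, ← intervalIntegral.integral_neg]
    refine intervalIntegral.integral_congr fun x _ => ?_
    simp only [mul_div_cancel_left₀ _ hn', smul_mul_assoc, smul_inv_smul₀ hn']
    ring
  rw [← intervalIntegral.integral_of_le n.cast_nonneg, hscale] at habel
  rw [← hsum, habel]
  ring

variable {f : ℕ → ℝ} {α c : ℝ}

theorem tendsto_rpow_mul_integral_tailMass (hα0 : 0 ≤ α) (hα : α < 1)
    (hf : Tendsto (fun n : ℕ => (n : ℝ) ^ α * tailMass f n) atTop (𝓝 c)) (hh' : Continuous h') :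
    Tendsto (fun n : ℕ => ((n : ℝ) ^ α : ℝ) *
        ∫ x in (0 : ℝ)..1, (tailMass f ⌊n * x⌋₊ : 𝕜) * h' x) atTop
      (𝓝 (c * ∫ x in (0 : ℝ)..1, ((x ^ (-α) : ℝ) : 𝕜) * h' x)) := by
  obtain ⟨M, hM⟩ := exists_add_one_rpow_mul_abs_le hf
  simp_rw [← intervalIntegral.integral_const_mul, ← mul_assoc, ← RCLike.ofReal_mul]
  refine intervalIntegral.tendsto_integral_filter_of_dominated_convergence
    (fun x => x ^ (-α) * (M * ‖h' x‖)) (.of_forall fun n => ?_) (.of_forall fun n => ?_) ?_ ?_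
  · have hfloor : Measurable fun x : ℝ => tailMass f ⌊n * x⌋₊ :=
      (measurable_of_countable (tailMass f)).comp
        (Nat.measurable_floor.comp (measurable_id.const_mul (n : ℝ)))
    exact ((RCLike.measurable_ofReal.comp (hfloor.const_mul _)).mul
      hh'.measurable).aestronglyMeasurable
  · refine .of_forall fun x hx => ?_
    rw [Set.uIoc_of_le zero_le_one] at hx
    have hle : (n : ℝ) ^ α * |tailMass f ⌊n * x⌋₊| ≤ x ^ (-α) * M := by
      rw [Real.rpow_neg hx.1.le, ← div_eq_inv_mul, le_div_iff₀ (Real.rpow_pos_of_pos hx.1 α)]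
      calc (n : ℝ) ^ α * |tailMass f ⌊n * x⌋₊| * x ^ α
          = (n * x) ^ α * |tailMass f ⌊n * x⌋₊| := by
            rw [Real.mul_rpow n.cast_nonneg hx.1.le]; ring
        _ ≤ (⌊n * x⌋₊ + 1 : ℝ) ^ α * |tailMass f ⌊n * x⌋₊| := by
            have := hx.1.le
            gcongr
            exact (Nat.lt_floor_add_one _).le
        _ ≤ M := hM _
    rw [norm_mul, RCLike.norm_ofReal, abs_mul, abs_of_nonneg (by positivity), ← mul_assoc]
    exact mul_le_mul_of_nonneg_right hle (norm_nonneg _)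
  · exact (intervalIntegral.intervalIntegrable_rpow' (by linarith)).mul_continuousOn
      (by fun_prop)
  · refine .of_forall fun x hx => ?_
    rw [Set.uIoc_of_le zero_le_one] at hx
    have hfloor := tendsto_rpow_mul_comp (k := fun n : ℕ => ⌊n * x⌋₊) hf hx.1 <| by
      simpa only [mul_comm x] using! (tendsto_nat_floor_mul_div_atTop hx.1.le).comp
        tendsto_natCast_atTop_atTop
    rw [mul_comm _ c] at hfloor
    exact ((RCLike.continuous_ofReal.tendsto _).comp hfloor).mul_const (h' x)

theorem tendsto_rpow_mul_sum_mul_comp_div (hα0 : 0 ≤ α) (hα : α < 1)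
    (hf : Tendsto (fun n : ℕ => (n : ℝ) ^ α * tailMass f n) atTop (𝓝 c))
    (hh : ∀ x, HasDerivAt h (h' x) x) (hh' : Continuous h') :
    Tendsto (fun n : ℕ => ((n : ℝ) ^ α : ℝ) *
        (∑ m ∈ Finset.range (n + 1), (f m : 𝕜) * h (m / n) - h 0)) atTop
      (𝓝 (c * ((∫ x in (0 : ℝ)..1, ((x ^ (-α) : ℝ) : 𝕜) * h' x) - h 1))) := by
  have htail := ((RCLike.continuous_ofReal (K := 𝕜)).tendsto c).comp hf
  have hlim := (tendsto_rpow_mul_integral_tailMass hα0 hα hf hh').sub (htail.mul_const (h 1))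
  rw [← mul_sub] at hlim
  refine hlim.congr' ?_
  filter_upwards [eventually_ne_atTop 0] with n hn
  rw [sum_mul_comp_div_eq_integral_tailMass f hh hh' hn, Function.comp_apply, RCLike.ofReal_mul]
  ring

end TailAsymptotics

/-! ### Darling–Mandelbrot laws -/

section DarlingMandelbrot

variable {f : ℕ → ℝ} {α c : ℝ}

theorem integral_rpow_neg_mul_pow (hα : α < 1) (m : ℕ) :
    ∫ x in (0 : ℝ)..1, x ^ (-α) * x ^ m = 1 / (m + 1 - α) := by
  have hm : 0 < (m : ℝ) + 1 - α := by linarith [m.cast_nonneg (α := ℝ)]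
  have hcongr : ∫ x in (0 : ℝ)..1, x ^ (-α) * x ^ m = ∫ x in (0 : ℝ)..1, x ^ (m - α) := by
    refine intervalIntegral.integral_congr_ae (.of_forall fun x hx => ?_)
    rw [Set.uIoc_of_le zero_le_one] at hx
    rw [← Real.rpow_natCast, ← Real.rpow_add hx.1, neg_add_eq_sub]
  rw [hcongr, integral_rpow (.inl (by linarith)), sub_add_eq_add_sub, Real.one_rpow,
    Real.zero_rpow hm.ne', sub_zero]

theorem hasSum_integral_rpow_neg_mul_exp (hα : α < 1) (z : ℂ) :
    HasSum (fun m : ℕ => (((1 / (m + 1 - α) : ℝ) : ℂ) * (z ^ (m + 1) / m.factorial)))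
      (∫ x in (0 : ℝ)..1, ((x ^ (-α) : ℝ) : ℂ) * (z * Complex.exp (z * x))) := by
  have hint : IntervalIntegrable (fun x : ℝ => x ^ (-α)) volume 0 1 :=
    intervalIntegral.intervalIntegrable_rpow' (by linarith)
  have hexp (w : ℂ) : HasSum (fun m : ℕ => w ^ m / m.factorial) (Complex.exp w) :=
    Complex.exp_eq_exp_ℂ ▸ NormedSpace.expSeries_div_hasSum_exp w
  have hbound : Summable fun m : ℕ => ‖z‖ ^ (m + 1) / m.factorial :=
    ((Real.summable_pow_div_factorial ‖z‖).mul_left ‖z‖).congr fun m => by ring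
  have hsum := intervalIntegral.hasSum_integral_of_dominated_convergence (a := 0) (b := 1)
    (μ := volume)
    (F := fun (m : ℕ) (x : ℝ) => ((x ^ (-α) : ℝ) : ℂ) * (z ^ (m + 1) / m.factorial * x ^ m))
    (f := fun x => ((x ^ (-α) : ℝ) : ℂ) * (z * Complex.exp (z * x)))
    (fun m x => x ^ (-α) * (‖z‖ ^ (m + 1) / m.factorial)) ?_ ?_ ?_ ?_ ?_
  · refine hsum.congr_fun fun m => ?_
    rw [← integral_rpow_neg_mul_pow hα, ← intervalIntegral.integral_ofReal,
      ← intervalIntegral.integral_mul_const]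
    refine intervalIntegral.integral_congr fun x _ => ?_
    push_cast
    ring
  · exact fun m => by fun_prop
  · refine fun m => .of_forall fun x hx => ?_
    rw [Set.uIoc_of_le zero_le_one] at hx
    rw [norm_mul, norm_mul, Complex.norm_real, Real.norm_of_nonneg (Real.rpow_nonneg hx.1.le _),
      norm_div, norm_pow, norm_pow, Complex.norm_natCast, Complex.norm_real,
      Real.norm_of_nonneg hx.1.le]
    gcongr
    · exact Real.rpow_nonneg hx.1.le _
    · exact mul_le_of_le_one_right (by positivity) (pow_le_one₀ hx.1.le hx.2)
  · exact .of_forall fun x _ => hbound.mul_left _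
  · simp_rw [tsum_mul_left]
    exact hint.mul_const _
  · refine .of_forall fun x _ => (((hexp (z * x)).mul_left z).mul_left _).congr_fun fun m => ?_
    ring

theorem inv_darlingMandelbrotCharFun (hα : α < 1) (t : ℝ) :
    (darlingMandelbrotCharFun α t)⁻¹ = Complex.exp (Complex.I * t) -
      ∫ x in (0 : ℝ)..1, ((x ^ (-α) : ℝ) : ℂ) *
        (Complex.I * t * Complex.exp (Complex.I * t * x)) := by
  have hexp : HasSum (fun m : ℕ => (Complex.I * t) ^ (m + 1) / (m + 1).factorial)
      (Complex.exp (Complex.I * t) - 1) := by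
    rw [Complex.exp_eq_exp_ℂ]
    simpa only [Finset.sum_range_one, pow_zero, Nat.factorial_zero, Nat.cast_one, div_one] using
      (hasSum_nat_add_iff' 1).2 (NormedSpace.expSeries_div_hasSum_exp (Complex.I * (t : ℂ)))
  have hseries := ((hasSum_integral_rpow_neg_mul_exp hα (Complex.I * t)).sub hexp).congr_fun
    (g := fun m : ℕ => (α : ℂ) / ((m + 1 : ℂ) - α) * (Complex.I * t) ^ (m + 1) /
      (m + 1).factorial) fun m => ?_
  · rw [darlingMandelbrotCharFun, inv_inv, hseries.tsum_eq]
    ring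
  · have hm : (m : ℂ) + 1 - α ≠ 0 := by
      have : 0 < (m : ℝ) + 1 - α := by linarith [m.cast_nonneg (α := ℝ)]
      exact_mod_cast this.ne'
    rw [Nat.factorial_succ]
    push_cast
    field_simp
    ring

theorem continuous_inv_darlingMandelbrotCharFun (hα : α < 1) :
    Continuous fun t => (darlingMandelbrotCharFun α t)⁻¹ := by
  have hcont : Continuous fun t : ℝ => ∫ x in (0 : ℝ)..1, ((x ^ (-α) : ℝ) : ℂ) *
      Complex.exp (Complex.I * t * x) := by
    refine intervalIntegral.continuous_of_dominated_interval (bound := fun x => x ^ (-α))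
      (fun t => by fun_prop) (fun t => .of_forall fun x hx => ?_)
      (intervalIntegral.intervalIntegrable_rpow' (by linarith)) (.of_forall fun x _ => by fun_prop)
    rw [Set.uIoc_of_le zero_le_one] at hx
    rw [norm_mul, mul_assoc, ← Complex.ofReal_mul, Complex.norm_exp_I_mul_ofReal, mul_one,
      Complex.norm_real, Real.norm_of_nonneg (Real.rpow_nonneg hx.1.le _)]
  simp_rw [inv_darlingMandelbrotCharFun hα, mul_left_comm _ (Complex.I * _),
    intervalIntegral.integral_const_mul]
  fun_prop

theorem tendsto_rpow_mul_one_sub_sum_mul_exp_pow (hα0 : 0 ≤ α) (hα : α < 1)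
    (hf : Tendsto (fun n : ℕ => (n : ℝ) ^ α * tailMass f n) atTop (𝓝 c)) (t : ℝ) :
    Tendsto (fun n : ℕ => ((n : ℝ) ^ α : ℝ) *
        (1 - ∑ m ∈ Finset.range (n + 1), f m * Complex.exp ((t / n : ℝ) * Complex.I) ^ m)) atTop
      (𝓝 (c * (darlingMandelbrotCharFun α t)⁻¹)) := by
  have hderiv (x : ℝ) : HasDerivAt (fun x : ℝ => Complex.exp (Complex.I * t * x))
      (Complex.I * t * Complex.exp (Complex.I * t * x)) x := by
    simpa only [Complex.ofReal_one, mul_one, mul_comm] using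
      ((hasDerivAt_id' x).ofReal_comp.const_mul (Complex.I * (t : ℂ))).cexp
  have hpow (n m : ℕ) : Complex.exp ((t / n : ℝ) * Complex.I) ^ m =
      Complex.exp (Complex.I * t * (m / n : ℝ)) := by
    rw [← Complex.exp_nat_mul]
    push_cast
    ring_nf
  have hlim := (tendsto_rpow_mul_sum_mul_comp_div hα0 hα hf hderiv (by fun_prop)).neg
  convert! hlim using 2 with n
  · rw [← mul_neg, neg_sub, Complex.ofReal_zero, mul_zero, Complex.exp_zero]
    simp_rw [hpow]
    rfl
  · rw [inv_darlingMandelbrotCharFun hα, ← mul_neg, neg_sub, Complex.ofReal_one, mul_one]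
    rfl

theorem exists_tailMass_eq {T : ℕ → ℝ} (hT : Antitone T) (h0 : T 0 ≤ 1) :
    ∃ f : ℕ → ℝ, (∀ m, 0 ≤ f m) ∧ ∀ n, tailMass f n = T n := by
  refine ⟨fun m => m.casesOn (1 - T 0) fun m => T m - T (m + 1), fun m => ?_, fun n => ?_⟩
  · cases m with
    | zero => exact sub_nonneg.2 h0
    | succ m => exact sub_nonneg.2 (hT m.le_succ)
  · rw [tailMass, Finset.sum_range_succ', Finset.sum_range_sub']
    change 1 - (T 0 - T n + (1 - T 0)) = T n
    ring

theorem exists_tendsto_rpow_mul_tailMass (hα0 : 0 ≤ α) :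
    ∃ f : ℕ → ℝ, (∀ m, 0 ≤ f m) ∧ (∀ n, 0 < tailMass f n) ∧
      Tendsto (fun n : ℕ => (n : ℝ) ^ α * tailMass f n) atTop (𝓝 1) := by
  obtain ⟨f, hf0, hf⟩ := exists_tailMass_eq (T := fun n : ℕ => ((n : ℝ) + 1) ^ (-α))
    (fun m n hmn => Real.rpow_le_rpow_of_nonpos (by positivity) (by gcongr) (neg_nonpos.2 hα0))
    (by simp)
  refine ⟨f, hf0, fun n => by rw [hf]; positivity, ?_⟩
  have h := (tendsto_natCast_add_div_atTop 1).rpow_const (p := -α) (.inl one_ne_zero)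
  rw [Real.one_rpow] at h
  refine h.congr fun n => ?_
  rw [hf, Real.div_rpow (by positivity) n.cast_nonneg, Real.rpow_neg n.cast_nonneg, div_inv_eq_mul,
    mul_comm, Nat.cast_add_one]

theorem one_le_re_inv_darlingMandelbrotCharFun (hα0 : 0 ≤ α) (hα : α < 1) (t : ℝ) :
    1 ≤ (darlingMandelbrotCharFun α t)⁻¹.re := by
  obtain ⟨f, hf0, -, hf⟩ := exists_tendsto_rpow_mul_tailMass hα0
  have hlim := (Complex.continuous_re.tendsto _).comp
    (tendsto_rpow_mul_one_sub_sum_mul_exp_pow hα0 hα hf t)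
  rw [Complex.ofReal_one, one_mul] at hlim
  refine le_of_tendsto_of_tendsto' hf hlim fun n => ?_
  rw [Function.comp_apply, Complex.re_ofReal_mul, Complex.sub_re, Complex.one_re, Complex.re_sum,
    tailMass]
  gcongr with m
  rw [Complex.re_ofReal_mul, ← Complex.exp_nat_mul]
  refine mul_le_of_le_one_right (hf0 m) ((Complex.re_le_norm _).trans ?_)
  rw [← mul_assoc, ← Complex.ofReal_natCast, ← Complex.ofReal_mul, Complex.norm_exp_ofReal_mul_I]

theorem darlingMandelbrotCharFun_ne_zero (hα0 : 0 ≤ α) (hα : α < 1) (t : ℝ) :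
    darlingMandelbrotCharFun α t ≠ 0 := by
  intro h
  have hre := one_le_re_inv_darlingMandelbrotCharFun hα0 hα t
  rw [h, inv_zero, Complex.zero_re] at hre
  linarith

end DarlingMandelbrot

section GeometricConvolution

instance isProbabilityMeasure_convPower (ν : Measure ℝ) [IsProbabilityMeasure ν] (k : ℕ) :
    IsProbabilityMeasure (convPower ν k) := by
  induction k with
  | zero => exact inferInstanceAs (IsProbabilityMeasure (Measure.dirac (0 : ℝ)))
  | succ k ih => exact inferInstanceAs (IsProbabilityMeasure (Measure.conv (convPower ν k) ν))

theorem charFun_convPower (ν : Measure ℝ) [IsProbabilityMeasure ν] (k : ℕ) (t : ℝ) :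
    charFun (convPower ν k) t = charFun ν t ^ k := by
  induction k with
  | zero => simp [convPower, charFun_dirac]
  | succ k ih => rw [convPower, charFun_conv, ih, pow_succ]

theorem integrable_cexp_mul (ν : Measure ℝ) [IsFiniteMeasure ν] (t : ℝ) :
    Integrable (fun x : ℝ => Complex.exp (t * x * Complex.I)) ν := by
  refine Integrable.of_bound (by fun_prop) 1 (ae_of_all _ fun x => ?_)
  rw [← Complex.ofReal_mul, Complex.norm_exp_ofReal_mul_I]

variable {p : ℝ} (ν : Measure ℝ) [IsProbabilityMeasure ν]

theorem isProbabilityMeasure_geometricConvolution (hp : 0 < p) (hp1 : p ≤ 1) :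
    IsProbabilityMeasure (geometricConvolution p ν) := by
  have h0 : 0 ≤ 1 - p := sub_nonneg.2 hp1
  have hgeom : HasSum (fun k : ℕ => (1 - p) ^ k * p) 1 := by
    have h := (hasSum_geometric_of_lt_one h0 (by linarith)).mul_right p
    rwa [sub_sub_cancel, inv_mul_cancel₀ hp.ne'] at h
  constructor
  rw [geometricConvolution, Measure.sum_apply _ MeasurableSet.univ]
  simp only [Measure.smul_apply, measure_univ, smul_eq_mul, mul_one]
  rw [← ENNReal.ofReal_tsum_of_nonneg (fun k => by positivity) hgeom.summable, hgeom.tsum_eq,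
    ENNReal.ofReal_one]

theorem charFun_geometricConvolution (hp : 0 < p) (hp1 : p ≤ 1) (t : ℝ) :
    charFun (geometricConvolution p ν) t =
      p * charFun ν t / (1 - (1 - p) * charFun ν t) := by
  have h0 : 0 ≤ 1 - p := sub_nonneg.2 hp1
  have := isProbabilityMeasure_geometricConvolution ν hp hp1
  have hsum := hasSum_integral_measure (integrable_cexp_mul (geometricConvolution p ν) t)
  rw [← geometricConvolution, ← charFun_apply_real] at hsum
  have hratio : ‖((1 - p : ℝ) : ℂ) * charFun ν t‖ < 1 := by
    rw [norm_mul, Complex.norm_real, Real.norm_of_nonneg h0]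
    exact (mul_le_of_le_one_right h0 (norm_charFun_le_one t)).trans_lt (by linarith)
  have hgeom := (hasSum_geometric_of_norm_lt_one hratio).mul_left (p * charFun ν t)
  rw [← div_eq_mul_inv, Complex.ofReal_sub, Complex.ofReal_one] at hgeom
  refine hsum.unique (hgeom.congr_fun fun k => ?_)
  rw [integral_smul_measure, ← charFun_apply_real, charFun_convPower,
    ENNReal.toReal_ofReal (by positivity), Complex.real_smul, mul_pow]
  push_cast
  ring

end GeometricConvolution

theorem exists_probabilityMeasure_of_tendsto_charFun {E : Type*} [NormedAddCommGroup E]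
    [InnerProductSpace ℝ E] [FiniteDimensional ℝ E] [MeasurableSpace E] [BorelSpace E]
    {ν : ℕ → Measure E} [∀ n, IsProbabilityMeasure (ν n)] {φ : E → ℂ} (hφ : ContinuousAt φ 0)
    (h : ∀ t, Tendsto (fun n => charFun (ν n) t) atTop (𝓝 (φ t))) :
    ∃ L : ProbabilityMeasure E, ∀ t, charFun (L : Measure E) t = φ t := by
  let P : ℕ → ProbabilityMeasure E := fun n => ⟨ν n, inferInstance⟩
  have hcompact : IsCompact (closure (Set.range P)) := by
    refine isCompact_closure_of_isTightMeasureSet ?_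
    have hrange : {m : Measure E | ∃ x ∈ Set.range P, (x : Measure E) = m} = Set.range ν :=
      (Set.range_comp (fun x : ProbabilityMeasure E => (x : Measure E)) P).symm
    rw [hrange]
    exact isTightMeasureSet_of_tendsto_charFun hφ h
  let U : Ultrafilter ℕ := Ultrafilter.of atTop
  obtain ⟨L, -, hL⟩ := hcompact.ultrafilter_le_nhds (U.map P)
    (le_principal_iff.2 (mem_map.2 (univ_mem' fun n => subset_closure ⟨n, rfl⟩)))
  refine ⟨L, fun t => ?_⟩
  have hchar := ProbabilityMeasure.tendsto_iff_forall_integral_rclike_tendsto ℂ |>.1 hL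
    (BoundedContinuousFunction.innerProbChar t)
  simp_rw [← charFun_eq_integral_innerProbChar] at hchar
  exact tendsto_nhds_unique hchar ((h t).mono_left (Ultrafilter.of_le atTop))

section TruncatedLaw

variable {f : ℕ → ℝ} {n : ℕ}

/-- The law of `X / n`, where `X` has law `f` on `ℕ`, with the values beyond `1` replaced
by `0`. -/
noncomputable def truncatedLaw (f : ℕ → ℝ) (n : ℕ) : Measure ℝ :=
  ∑ m ∈ Finset.range (n + 1), ENNReal.ofReal (f m) • Measure.dirac ((m : ℝ) / n) +
    ENNReal.ofReal (tailMass f n) • Measure.dirac 0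

theorem isProbabilityMeasure_truncatedLaw (hf : ∀ m, 0 ≤ f m) (hn : 0 ≤ tailMass f n) :
    IsProbabilityMeasure (truncatedLaw f n) := by
  constructor
  simp only [truncatedLaw, Measure.add_apply, Measure.finsetSum_apply, Measure.smul_apply,
    measure_univ, smul_eq_mul, mul_one]
  rw [← ENNReal.ofReal_sum_of_nonneg fun m _ => hf m,
    ← ENNReal.ofReal_add (Finset.sum_nonneg fun m _ => hf m) hn, tailMass, add_sub_cancel,
    ENNReal.ofReal_one]

theorem charFun_truncatedLaw (hf : ∀ m, 0 ≤ f m) (hn : 0 ≤ tailMass f n) (t : ℝ) :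
    charFun (truncatedLaw f n) t =
      ∑ m ∈ Finset.range (n + 1), f m * Complex.exp ((t / n : ℝ) * Complex.I) ^ m +
        tailMass f n := by
  have hint (w x : ℝ) : Integrable (fun x : ℝ => Complex.exp (t * x * Complex.I))
      (ENNReal.ofReal w • Measure.dirac x) :=
    (integrable_cexp_mul _ t).smul_measure ENNReal.ofReal_ne_top
  rw [charFun_apply_real, truncatedLaw, integral_add_measure
    (integrable_finsetSum_measure.2 fun m _ => hint _ _) (hint _ _),
    integral_finsetSum_measure fun m _ => hint _ _]
  simp only [integral_smul_measure, integral_dirac, Complex.real_smul,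
    ENNReal.toReal_ofReal (hf _), ENNReal.toReal_ofReal hn, ← Complex.exp_nat_mul,
    Complex.ofReal_zero, mul_zero, zero_mul, Complex.exp_zero, mul_one]
  congr! 4
  push_cast
  ring

end TruncatedLaw

section Limits

variable {f s : ℕ → ℝ} {α c p : ℝ}

theorem tendsto_charFun_geometricConvolution_truncatedLaw (hα0 : 0 < α) (hα : α < 1)
    (hf0 : ∀ m, 0 ≤ f m) (hT : ∀ n, 0 < tailMass f n) (hc : c ≠ 0)
    (hf : Tendsto (fun n : ℕ => (n : ℝ) ^ α * tailMass f n) atTop (𝓝 c)) (t : ℝ) :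
    Tendsto (fun n => charFun (geometricConvolution (tailMass f n) (truncatedLaw f n)) t) atTop
      (𝓝 (darlingMandelbrotCharFun α t)) := by
  have hT1 (n : ℕ) : tailMass f n ≤ 1 := sub_le_self _ (Finset.sum_nonneg fun m _ => hf0 m)
  have htail : Tendsto (fun n : ℕ => ((n : ℝ) ^ α : ℝ) * (tailMass f n : ℂ)) atTop (𝓝 c) := by
    exact_mod_cast (Complex.continuous_ofReal.tendsto c).comp hf
  have hsum := tendsto_rpow_mul_one_sub_sum_mul_exp_pow hα0.le hα hf t
  have hpow : ∀ᶠ n : ℕ in atTop, (((n : ℝ) ^ α : ℝ) : ℂ) ≠ 0 := by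
    filter_upwards [eventually_gt_atTop 0] with n hn
    exact Complex.ofReal_ne_zero.2 (by positivity)
  have hone : Tendsto (fun n => 1 - charFun (truncatedLaw f n) t) atTop (𝓝 0) := by
    have hinv := (Complex.continuous_ofReal.tendsto 0).comp
      ((tendsto_rpow_atTop hα0).comp tendsto_natCast_atTop_atTop).inv_tendsto_atTop
    have h := hinv.mul (hsum.sub htail)
    rw [Complex.ofReal_zero, zero_mul] at h
    refine h.congr' ?_
    filter_upwards [hpow] with n hn
    rw [charFun_truncatedLaw hf0 (hT n).le, ← mul_sub]
    simp only [Function.comp_apply, Pi.inv_apply, Complex.ofReal_inv, inv_mul_cancel_left₀ hn]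
    ring
  have hlim := (htail.mul (hone.const_sub 1)).div (hsum.sub (htail.mul hone))
    (by simpa using ⟨hc, darlingMandelbrotCharFun_ne_zero hα0.le hα t⟩)
  have hval : (c : ℂ) * (1 - 0) / (c * (darlingMandelbrotCharFun α t)⁻¹ - c * 0) =
      darlingMandelbrotCharFun α t := by
    rw [sub_zero, mul_zero, sub_zero, mul_div_mul_left _ _ (Complex.ofReal_ne_zero.2 hc), one_div,
      inv_inv]
  rw [hval] at hlim
  refine hlim.congr' ?_
  filter_upwards [hpow] with n hn
  have := isProbabilityMeasure_truncatedLaw hf0 (hT n).le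
  rw [Pi.div_apply, charFun_geometricConvolution _ (hT n) (hT1 n), mul_assoc, mul_assoc, ← mul_sub,
    mul_div_mul_left _ _ hn, sub_sub_cancel, charFun_truncatedLaw hf0 (hT n).le]
  congr 1
  ring

theorem exists_isShiftedDarlingMandelbrot (hα0 : 0 < α) (hα : α < 1) :
    ∃ ν : Measure ℝ, IsShiftedDarlingMandelbrot α ν := by
  obtain ⟨f, hf0, hT, hf⟩ := exists_tendsto_rpow_mul_tailMass hα0.le
  have (n : ℕ) : IsProbabilityMeasure (geometricConvolution (tailMass f n) (truncatedLaw f n)) :=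
    have := isProbabilityMeasure_truncatedLaw hf0 (hT n).le
    isProbabilityMeasure_geometricConvolution _ (hT n)
      (sub_le_self _ (Finset.sum_nonneg fun m _ => hf0 m))
  have hcont : ContinuousAt (darlingMandelbrotCharFun α) 0 := by
    have h := (continuous_inv_darlingMandelbrotCharFun hα).inv₀ fun t =>
      inv_ne_zero (darlingMandelbrotCharFun_ne_zero hα0.le hα t)
    simpa only [Pi.inv_def, inv_inv] using h.continuousAt
  obtain ⟨L, hL⟩ := exists_probabilityMeasure_of_tendsto_charFun hcont fun t =>
    tendsto_charFun_geometricConvolution_truncatedLaw hα0 hα hf0 hT one_ne_zero hf t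
  refine ⟨(Measure.dirac 1).conv L, inferInstance, fun t => ?_⟩
  rw [charFun_conv, hL, charFun_dirac]
  simp [mul_comm]

theorem exists_isGeometricDarlingMandelbrot (hα0 : 0 < α) (hα : α < 1) (hp : 0 < p)
    (hp1 : p ≤ 1) : ∃ L : ProbabilityMeasure ℝ, IsGeometricDarlingMandelbrot α p L := by
  obtain ⟨ν, hν⟩ := exists_isShiftedDarlingMandelbrot hα0 hα
  have := hν.isProbabilityMeasure
  exact ⟨⟨_, isProbabilityMeasure_geometricConvolution ν hp hp1⟩, ν, hν, rfl⟩

theorem inv_darlingMandelbrotCharFun_sub_ne_zero (hα0 : 0 ≤ α) (hα : α < 1) (t : ℝ) {w : ℂ}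
    (hw : ‖w‖ < 1) : (darlingMandelbrotCharFun α t)⁻¹ - w ≠ 0 := by
  intro h
  have hre := (one_le_re_inv_darlingMandelbrotCharFun hα0 hα t).trans (Complex.re_le_norm _)
  rw [sub_eq_zero.1 h] at hre
  linarith

theorem IsGeometricDarlingMandelbrot.charFun_eq {L : Measure ℝ}
    (hL : IsGeometricDarlingMandelbrot α p L) (hα0 : 0 ≤ α) (hα : α < 1) (hp : 0 < p)
    (hp1 : p ≤ 1) (t : ℝ) : charFun L t = p * Complex.exp (t * Complex.I) /
      ((darlingMandelbrotCharFun α t)⁻¹ - (1 - p) * Complex.exp (t * Complex.I)) := by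
  obtain ⟨ν, hν, rfl⟩ := hL
  have := hν.isProbabilityMeasure
  have hne := darlingMandelbrotCharFun_ne_zero hα0 hα t
  rw [charFun_geometricConvolution ν hp hp1, hν.charFun_eq, mul_comm Complex.I,
    ← mul_div_mul_right (p * Complex.exp _) (_ - _) hne, sub_mul _⁻¹, inv_mul_cancel₀ hne,
    mul_assoc, mul_assoc]

theorem tendsto_cexp_div_mul_I_pow_add (t : ℝ) (j : ℕ) :
    Tendsto (fun n : ℕ => Complex.exp ((t / n : ℝ) * Complex.I) ^ (n + j)) atTop
      (𝓝 (Complex.exp (t * Complex.I))) := by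
  have hexp : Continuous fun x : ℝ => Complex.exp ((t * x : ℝ) * Complex.I) := by fun_prop
  have h := (hexp.tendsto 1).comp (tendsto_natCast_add_div_atTop j)
  rw [mul_one] at h
  refine h.congr fun n => ?_
  rw [Function.comp_apply, ← Complex.exp_nat_mul]
  push_cast
  ring_nf

theorem tendsto_restartGenFun (hα0 : 0 ≤ α) (hα : α < 1) (hp : 0 < p) (hp1 : p ≤ 1) (hc : c ≠ 0)
    (hf : Tendsto (fun n : ℕ => (n : ℝ) ^ α * tailMass f n) atTop (𝓝 c))
    (hs : Tendsto (fun n : ℕ => (n : ℝ) ^ α * s n) atTop (𝓝 (p * c))) {L : Measure ℝ}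
    (hL : IsGeometricDarlingMandelbrot α p L) (t : ℝ) :
    Tendsto (fun n : ℕ => restartGenFun f s n (Complex.exp ((t / n : ℝ) * Complex.I))) atTop
      (𝓝 (charFun L t)) := by
  set e := Complex.exp (t * Complex.I) with he
  have hexp := tendsto_cexp_div_mul_I_pow_add t
  have hsuccess : Tendsto (fun n : ℕ => ((n : ℝ) ^ α : ℝ) * (s n : ℂ)) atTop (𝓝 (p * c)) := by
    exact_mod_cast (Complex.continuous_ofReal.tendsto _).comp hs
  have hover : Tendsto (fun n : ℕ => ((n : ℝ) ^ α : ℝ) * ((tailMass f n - s n : ℝ) : ℂ)) atTop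
      (𝓝 (c - p * c)) := by
    have h := (Complex.continuous_ofReal.tendsto _).comp (hf.sub hs)
    push_cast at h
    refine h.congr fun n => ?_
    simp only [Function.comp_apply]
    push_cast
    ring
  have hden := (tendsto_rpow_mul_one_sub_sum_mul_exp_pow hα0 hα hf t).sub
    (hover.mul (hexp 1))
  have hval : (c : ℂ) * (darlingMandelbrotCharFun α t)⁻¹ - (c - p * c) * e =
      c * ((darlingMandelbrotCharFun α t)⁻¹ - (1 - p) * e) := by ring
  have hw : ‖(1 - p) * e‖ < 1 := by
    rw [he, norm_mul, Complex.norm_exp_ofReal_mul_I, mul_one, ← Complex.ofReal_one,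
      ← Complex.ofReal_sub, Complex.norm_real, Real.norm_of_nonneg (sub_nonneg.2 hp1)]
    linarith
  rw [hval] at hden
  have hc' : (c : ℂ) ≠ 0 := Complex.ofReal_ne_zero.2 hc
  have hlim := (hsuccess.mul (hexp 0)).div hden
    (mul_ne_zero hc' (inv_darlingMandelbrotCharFun_sub_ne_zero hα0 hα t hw))
  rw [mul_right_comm, mul_comm _ (c : ℂ), mul_div_mul_left _ _ hc',
    ← hL.charFun_eq hα0 hα hp hp1] at hlim
  refine hlim.congr' ?_
  filter_upwards [eventually_gt_atTop 0] with n hn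
  have hn' : (((n : ℝ) ^ α : ℝ) : ℂ) ≠ 0 := Complex.ofReal_ne_zero.2 (by positivity)
  rw [Pi.div_apply, mul_assoc, mul_assoc, ← mul_sub, mul_div_mul_left _ _ hn', restartGenFun,
    failGenFun, sub_sub, add_zero]

theorem tendsto_rpow_mul_sum_mul_natCast_div (hα0 : 0 ≤ α) (hα : α < 1)
    (hf : Tendsto (fun n : ℕ => (n : ℝ) ^ α * tailMass f n) atTop (𝓝 c)) :
    Tendsto (fun n : ℕ => (n : ℝ) ^ α * ((∑ m ∈ Finset.range (n + 1), f m * m) / n)) atTop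
      (𝓝 (c * ((1 - α)⁻¹ - 1))) := by
  have hlim := tendsto_rpow_mul_sum_mul_comp_div (𝕜 := ℝ) hα0 hα hf (fun x => hasDerivAt_id' x)
    continuous_const
  have hint : ∫ x in (0 : ℝ)..1, x ^ (-α) * 1 = (1 - α)⁻¹ := by
    simpa only [pow_zero, Nat.cast_zero, zero_add, one_div] using integral_rpow_neg_mul_pow hα 0
  simpa only [RCLike.ofReal_real_eq_id, id_eq, sub_zero, hint, Finset.sum_div, mul_div_assoc]
    using hlim

theorem isEquivalent_restartMean (hα0 : 0 ≤ α) (hα : α < 1) (hp : p ≠ 0) (hc : c ≠ 0)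
    (hf : Tendsto (fun n : ℕ => (n : ℝ) ^ α * tailMass f n) atTop (𝓝 c))
    (hs : Tendsto (fun n : ℕ => (n : ℝ) ^ α * s n) atTop (𝓝 (p * c))) :
    restartMean f s ~[atTop] fun n : ℕ => (p * (1 - α))⁻¹ * (n : ℝ) := by
  have hα' : 1 - α ≠ 0 := (sub_pos.2 hα).ne'
  have hnum := ((tendsto_rpow_mul_sum_mul_natCast_div hα0 hα hf).add
    ((hf.sub hs).mul (tendsto_natCast_add_div_atTop 1))).add hs
  have hlim := (hnum.div hs (mul_ne_zero hp hc)).div_const (p * (1 - α))⁻¹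
  have hval : (c * ((1 - α)⁻¹ - 1) + (c - p * c) * 1 + p * c) / (p * c) / (p * (1 - α))⁻¹ = 1 := by
    field_simp
    ring
  rw [hval] at hlim
  refine isEquivalent_of_tendsto_one (hlim.congr' ?_)
  filter_upwards [eventually_gt_atTop 0] with n hn
  have hn' : (n : ℝ) ≠ 0 := Nat.cast_ne_zero.2 hn.ne'
  have hpow : (n : ℝ) ^ α ≠ 0 := by positivity
  rw [Pi.div_apply, Pi.div_apply, restartMean, ← mul_sub, mul_assoc, ← mul_add, ← mul_add,
    mul_div_mul_left _ _ hpow]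
  push_cast
  field_simp

end Limits

/-! ### Generating functions of Schröder prefixes -/

namespace SchroderSampler

open PowerSeries

/-- The series of `(1 - X)^(-1/2)`. -/
noncomputable def centralBinomSeries : PowerSeries ℝ :=
  mk fun n => (n.centralBinom : ℝ) / 4 ^ n

theorem coeff_succ_centralBinomSeries_sub (n : ℕ) :
    coeff (n + 1) centralBinomSeries - coeff n centralBinomSeries =
      -(1 / 2) * ((1 / 4) ^ n * catalan n) := by
  have hsucc : ((n : ℝ) + 1) * (n + 1).centralBinom = 2 * (2 * n + 1) * n.centralBinom := by
    exact_mod_cast Nat.succ_mul_centralBinom_succ n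
  have hcatalan : ((n : ℝ) + 1) * catalan n = n.centralBinom := by
    exact_mod_cast succ_mul_catalan_eq_centralBinom n
  have hn : (n : ℝ) + 1 ≠ 0 := by positivity
  rw [centralBinomSeries, coeff_mk, coeff_mk, ← hcatalan]
  rw [← hcatalan] at hsucc
  replace hsucc := mul_left_cancel₀ hn (hsucc.trans (mul_left_comm _ _ _))
  rw [hsucc, pow_succ, one_div_pow]
  field_simp
  ring

theorem two_mul_C_div_two (a : ℝ) : 2 * C (a / 2) = C a := by
  rw [← map_ofNat C 2, ← map_mul, mul_div_cancel₀ _ two_ne_zero]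

theorem centralBinomSeries_sq_mul_one_sub_X : centralBinomSeries ^ 2 * (1 - X) = 1 := by
  have two_mul_C_half : 2 * C (1 / 2) = (1 : PowerSeries ℝ) := by
    rw [two_mul_C_div_two, map_one]
  have sq_C_half : (C (1 / 2) : PowerSeries ℝ) ^ 2 = C (1 / 4) := by
    rw [← map_pow]
    norm_num
  set K : PowerSeries ℝ := rescale (1 / 4) (map (Nat.castRingHom ℝ) catalanSeries) with hK
  have hK_eq : K ^ 2 * (C (1 / 4) * X) + 1 = K := by
    have h := congrArg (fun f => rescale (1 / 4 : ℝ) (map (Nat.castRingHom ℝ) f))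
      catalanSeries_sq_mul_X_add_one
    simpa only [map_add, map_mul, map_pow, map_X, rescale_X, map_one] using h
  have hB : centralBinomSeries * (1 - X) = 1 - C (1 / 2) * X * K := by
    ext n
    rcases n with _ | n
    · simp [centralBinomSeries]
    · rw [mul_sub, mul_one, map_sub, coeff_succ_mul_X, coeff_succ_centralBinomSeries_sub,
        mul_assoc, map_sub, coeff_C_mul, coeff_succ_X_mul, hK, coeff_rescale, coeff_map,
        catalanSeries_coeff, coeff_one]
      simp
  have hX : (1 - X : PowerSeries ℝ) ≠ 0 := fun h => by simpa using congrArg constantCoeff h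
  refine mul_right_cancel₀ hX ?_
  linear_combination (centralBinomSeries * (1 - X) + (1 - C (1 / 2) * X * K)) * hB +
    X * hK_eq + X ^ 2 * K ^ 2 * sq_C_half - X * K * two_mul_C_half

/-- The series of `√((1 + X) / (1 - X))`. -/
noncomputable def sqrtSeries : PowerSeries ℝ :=
  (1 + X) * expand 2 two_ne_zero centralBinomSeries

theorem sqrtSeries_sq_mul_one_sub_X : sqrtSeries ^ 2 * (1 - X) = 1 + X := by
  have h := congrArg (expand 2 two_ne_zero) centralBinomSeries_sq_mul_one_sub_X
  rw [map_mul, map_pow, map_sub, map_one, expand_X] at h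
  rw [sqrtSeries]
  linear_combination (1 + X) * h

theorem coeff_sqrtSeries (n : ℕ) :
    coeff n sqrtSeries = ((n / 2).centralBinom : ℝ) / 4 ^ (n / 2) := by
  obtain ⟨k, rfl | rfl⟩ := Nat.even_or_odd' n
  · rw [Nat.mul_div_cancel_left k two_pos, sqrtSeries, add_mul, one_mul, map_add,
      coeff_expand_mul, centralBinomSeries, coeff_mk, add_eq_left]
    rcases k with _ | k
    · simp
    · rw [show 2 * (k + 1) = 2 * k + 1 + 1 by ring, coeff_succ_X_mul,
        coeff_expand_of_not_dvd _ _ _ (by lia)]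
  · rw [show (2 * k + 1) / 2 = k by lia, sqrtSeries, add_mul, one_mul, map_add, coeff_succ_X_mul,
      coeff_expand_mul, coeff_expand_of_not_dvd _ _ _ (by lia), zero_add, centralBinomSeries,
      coeff_mk]

section Series

variable (q : ℝ)

/-- The series of `√((1 + X) (1 - q X) / ((1 - X) (1 + q X)))`. -/
noncomputable def ratioSeries : PowerSeries ℝ := sqrtSeries * rescale (-q) sqrtSeries

/-- The denominator `1 - (1 - q) X - q X²` of the generating function of all paths. -/
noncomputable def stepDenom : PowerSeries ℝ := (1 - X) * (1 + C q * X)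

theorem constantCoeff_stepDenom : constantCoeff (stepDenom q) = 1 := by simp [stepDenom]

theorem stepDenom_eq : stepDenom q = 1 - 2 * C ((1 - q) / 2) * X - C q * X ^ 2 := by
  rw [stepDenom, two_mul_C_div_two, map_sub, map_one]
  ring

theorem ratioSeries_sq_mul_stepDenom :
    ratioSeries q ^ 2 * stepDenom q = (1 + X) * (1 - C q * X) := by
  have h := congrArg (rescale (-q)) sqrtSeries_sq_mul_one_sub_X
  simp only [map_mul, map_pow, map_sub, map_add, map_one, rescale_X, map_neg] at h
  rw [ratioSeries, stepDenom]
  linear_combination (rescale (-q) sqrtSeries) ^ 2 * (1 + C q * X) * sqrtSeries_sq_mul_one_sub_X +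
    (1 + X) * h

theorem constantCoeff_ratioSeries : constantCoeff (ratioSeries q) = 1 := by
  rw [ratioSeries, map_mul, ← coeff_zero_eq_constantCoeff_apply,
    ← coeff_zero_eq_constantCoeff_apply, coeff_rescale, coeff_sqrtSeries]
  simp

/-- The generating function of the weighted paths from height `0` that never go below `0`,
in closed form. -/
noncomputable def prefixSeries : PowerSeries ℝ :=
  C (1 - q)⁻¹ * mk fun n => coeff (n + 1) (ratioSeries q)

/-- The generating function of the weighted paths from height `0` whose last step is the first
to go below `0`. The formula follows from cutting an arbitrary path at that step. -/
noncomputable def hitSeries : PowerSeries ℝ := 1 - stepDenom q * prefixSeries q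

/-- The generating function of the weighted paths from height `k - 1` that never go below `0`. -/
noncomputable def aliveSeries (k : ℕ) : PowerSeries ℝ :=
  (∑ i ∈ Finset.range k, hitSeries q ^ i) * prefixSeries q

/-- The generating function, in the target length plus one, of the probability that the path from
height `k - 1` overshoots its target length. The constant coefficient accounts for the path which
has already done so. -/
noncomputable def overshootSeries (k : ℕ) : PowerSeries ℝ :=
  1 + C q * X ^ 2 * aliveSeries q k

/-- The probability that the first step below `0` of a path from height `0` is at length `m`. -/
noncomputable def passageProb (m : ℕ) : ℝ := coeff m (hitSeries q)

/-- The probability that a path from height `0` reaches length `n` without going below `0`. -/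
noncomputable def aliveProb (n : ℕ) : ℝ := coeff n (prefixSeries q)

variable {q}

theorem one_sub_C_mul_X_mul_prefixSeries (hq : q < 1) :
    (1 - C q) * X * prefixSeries q = ratioSeries q - 1 := by
  have h := sub_const_eq_X_mul_shift (ratioSeries q)
  rw [constantCoeff_ratioSeries, map_one] at h
  rw [h, prefixSeries, ← map_one C, ← map_sub, mul_mul_mul_comm, ← map_mul,
    mul_inv_cancel₀ (sub_pos.2 hq).ne', map_one, one_mul]

theorem stepDenom_mul_prefixSeries_add (hq : q < 1) :
    stepDenom q * (prefixSeries q + C ((1 - q) / 2) * X * prefixSeries q ^ 2) = 1 := by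
  have hX : (C (2 * (1 - q)) * X : PowerSeries ℝ) ≠ 0 := by
    refine mul_ne_zero ((map_ne_zero_iff _ C_injective).2 ?_) X_ne_zero
    exact mul_ne_zero two_ne_zero (sub_pos.2 hq).ne'
  refine mul_left_cancel₀ hX ?_
  have hC : 2 * C ((1 - q) / 2) = 1 - C q := by rw [two_mul_C_div_two, map_sub, map_one]
  have hD : stepDenom q = (1 - X) * (1 + C q * X) := rfl
  rw [map_mul, map_ofNat, map_sub, map_one]
  linear_combination
    stepDenom q * ((1 - C q) * X * prefixSeries q + ratioSeries q + 1) *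
      one_sub_C_mul_X_mul_prefixSeries hq + ratioSeries_sq_mul_stepDenom q - hD +
    (1 - C q) * X ^ 2 * stepDenom q * prefixSeries q ^ 2 * hC

theorem hitSeries_eq (hq : q < 1) :
    hitSeries q = C ((1 - q) / 2) * X * (1 + hitSeries q ^ 2) + C q * X ^ 2 * hitSeries q := by
  rw [hitSeries]
  linear_combination (-stepDenom q) * stepDenom_mul_prefixSeries_add hq -
    (1 - stepDenom q * prefixSeries q) * stepDenom_eq q

theorem stepDenom_mul_geom_sum_mul_prefixSeries (k : ℕ) :
    stepDenom q * ((∑ i ∈ Finset.range k, hitSeries q ^ i) * prefixSeries q) =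
      1 - hitSeries q ^ k := by
  have h := geom_sum_mul_neg (hitSeries q) k
  rw [show 1 - hitSeries q = stepDenom q * prefixSeries q by rw [hitSeries]; ring] at h
  linear_combination h

theorem aliveSeries_zero : aliveSeries q 0 = 0 := by simp [aliveSeries]

theorem aliveSeries_one : aliveSeries q 1 = prefixSeries q := by simp [aliveSeries]

theorem hitSeries_pow_succ (hq : q < 1) (k : ℕ) :
    hitSeries q ^ (k + 1) = C ((1 - q) / 2) * X * (hitSeries q ^ (k + 2) + hitSeries q ^ k) +
      C q * X ^ 2 * hitSeries q ^ (k + 1) := by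
  linear_combination hitSeries q ^ k * hitSeries_eq hq

theorem aliveSeries_succ (hq : q < 1) (k : ℕ) :
    aliveSeries q (k + 1) = 1 + C ((1 - q) / 2) * X * (aliveSeries q (k + 2) + aliveSeries q k) +
      C q * X ^ 2 * aliveSeries q (k + 1) := by
  have hD : stepDenom q ≠ 0 := fun h => by
    simpa [constantCoeff_stepDenom q] using congrArg constantCoeff h
  have hA (j : ℕ) : stepDenom q * aliveSeries q j = 1 - hitSeries q ^ j :=
    stepDenom_mul_geom_sum_mul_prefixSeries j
  refine mul_left_cancel₀ hD ?_
  linear_combination (1 - C q * X ^ 2) * hA (k + 1) -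
    C ((1 - q) / 2) * X * (hA (k + 2) + hA k) - hitSeries_pow_succ hq k - stepDenom_eq q

theorem overshootSeries_succ (hq : q < 1) (k : ℕ) :
    overshootSeries q (k + 1) = 1 - C (1 - q) * X +
      C ((1 - q) / 2) * X * (overshootSeries q (k + 2) + overshootSeries q k) +
      C q * X ^ 2 * overshootSeries q (k + 1) := by
  simp only [overshootSeries]
  rw [← two_mul_C_div_two (1 - q)]
  linear_combination C q * X ^ 2 * aliveSeries_succ hq k

theorem coeff_add_two_of_eq {p q : ℝ} {f g h l : PowerSeries ℝ}
    (h_eq : f = l + C p * X * g + C q * X ^ 2 * h) (n : ℕ) (hl : coeff (n + 2) l = 0) :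
    coeff (n + 2) f = p * coeff (n + 1) g + q * coeff n h := by
  rw [h_eq, map_add, map_add, hl, mul_assoc, mul_assoc, coeff_C_mul, coeff_C_mul, pow_two,
    mul_assoc, coeff_succ_X_mul, coeff_succ_X_mul, coeff_succ_X_mul, zero_add]

theorem coeff_overshootSeries_add_two (hq : q < 1) (k r : ℕ) :
    coeff (r + 2) (overshootSeries q (k + 1)) =
      (1 - q) / 2 *
          (coeff (r + 1) (overshootSeries q (k + 2)) + coeff (r + 1) (overshootSeries q k)) +
        q * coeff r (overshootSeries q (k + 1)) := by
  rw [← map_add]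
  refine coeff_add_two_of_eq (overshootSeries_succ hq k) r ?_
  simp [coeff_one, coeff_succ_mul_X]

theorem coeff_one_overshootSeries (k : ℕ) : coeff 1 (overshootSeries q k) = 0 := by
  rw [overshootSeries, mul_right_comm, map_add, coeff_mul_X_pow']
  simp [coeff_one]

theorem coeff_X_mul_aliveSeries_add_two (hq : q < 1) (k r : ℕ) :
    coeff (r + 2) (X * aliveSeries q (k + 1)) =
      (1 - q) / 2 *
          (coeff (r + 1) (X * aliveSeries q (k + 2)) + coeff (r + 1) (X * aliveSeries q k)) +
        q * coeff r (X * aliveSeries q (k + 1)) := by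
  rw [← map_add]
  refine coeff_add_two_of_eq (l := X) ?_ r (by simp [coeff_X])
  linear_combination X * aliveSeries_succ hq k

theorem constantCoeff_aliveSeries_succ (hq : q < 1) (k : ℕ) :
    constantCoeff (aliveSeries q (k + 1)) = 1 := by
  rw [aliveSeries_succ hq]
  simp

theorem constantCoeff_hitSeries (hq : q < 1) : constantCoeff (hitSeries q) = 0 := by
  rw [hitSeries_eq hq]
  simp

end Series

/-- The expected reward of a path with `k = height + 1` and `r = target + 1 - length`, drawn until
it goes below `0` (`k = 0`), jumps over the target (`r = 0`) or reaches it (`r = 1`). The reward is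
`ψ` in the last case and `φ` in the two others, both evaluated at `a` plus the length drawn. -/
noncomputable def payoff {E : Type*} [AddCommGroup E] [Module ℝ E] (q : ℝ) (φ ψ : ℕ → E) :
    ℕ → ℕ → ℕ → E
  | 0, _, a => φ a
  | _ + 1, 0, a => φ a
  | 1, _ + 1, a => ψ a
  | r + 2, k + 1, a =>
    ((1 - q) / 2) • payoff q φ ψ (r + 1) (k + 2) (a + 1) +
      ((1 - q) / 2) • payoff q φ ψ (r + 1) k (a + 1) + q • payoff q φ ψ r (k + 1) (a + 2)

section Payoff

variable {E : Type*} [AddCommGroup E] [Module ℝ E] {q : ℝ} {φ ψ : ℕ → E}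

@[simp]
theorem payoff_zero_right (r a : ℕ) : payoff q φ ψ r 0 a = φ a := by
  cases r <;> rw [payoff]

theorem payoff_mem (hq0 : 0 ≤ q) (hq : q < 1) {s : Set E} (hs : Convex ℝ s) (r k a : ℕ)
    (hφ : ∀ b, a ≤ b → b ≤ a + r → φ b ∈ s) (hψ : ∀ b, a ≤ b → b ≤ a + r → ψ b ∈ s) :
    payoff q φ ψ r k a ∈ s := by
  induction r using Nat.strong_induction_on generalizing k a with
  | _ r ih =>
  match r, k with
  | 0, _ => rw [payoff]; exact hφ a le_rfl le_rfl
  | _ + 1, 0 => rw [payoff]; exact hφ a le_rfl (by lia)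
  | 1, _ + 1 => rw [payoff]; exact hψ a le_rfl (by lia)
  | r + 2, k + 1 =>
    rw [payoff]
    have hmem := hs.sum_mem (t := Finset.univ) (w := ![(1 - q) / 2, (1 - q) / 2, q])
      (z := ![payoff q φ ψ (r + 1) (k + 2) (a + 1), payoff q φ ψ (r + 1) k (a + 1),
        payoff q φ ψ r (k + 1) (a + 2)])
    simp only [Finset.mem_univ, forall_const, Fin.sum_univ_three, Fin.forall_fin_succ] at hmem
    refine hmem ⟨by simp; linarith, by simp; linarith, by simpa, by simp⟩ (by simp)
      ⟨ih _ (by lia) _ _ ?_ ?_, ih _ (by lia) _ _ ?_ ?_, ih _ (by lia) _ _ ?_ ?_, by simp⟩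
    all_goals
      intro b hab hb
      first | exact hφ b (by lia) (by lia) | exact hψ b (by lia) (by lia)

open Finset in
theorem sum_coeff_hitSeries_pow_smul (hq : q < 1) (r k : ℕ) (φ : ℕ → E) :
    ∑ m ∈ range (r + 2), coeff m (hitSeries q ^ (k + 1)) • φ m =
      ((1 - q) / 2) • ∑ m ∈ range (r + 1), coeff m (hitSeries q ^ (k + 2)) • φ (m + 1) +
      ((1 - q) / 2) • ∑ m ∈ range (r + 1), coeff m (hitSeries q ^ k) • φ (m + 1) +
      q • ∑ m ∈ range r, coeff m (hitSeries q ^ (k + 1)) • φ (m + 2) := by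
  have hcoeff (m : ℕ) : coeff (m + 1) (hitSeries q ^ (k + 1)) =
      (1 - q) / 2 * coeff m (hitSeries q ^ (k + 2)) + (1 - q) / 2 * coeff m (hitSeries q ^ k) +
        q * coeff m (X * hitSeries q ^ (k + 1)) := by
    have h : hitSeries q ^ (k + 1) = X * (C ((1 - q) / 2) * hitSeries q ^ (k + 2) +
        C ((1 - q) / 2) * hitSeries q ^ k + C q * (X * hitSeries q ^ (k + 1))) := by
      linear_combination hitSeries_pow_succ hq k
    conv_lhs => rw [h, coeff_succ_X_mul]
    simp only [map_add, coeff_C_mul]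
  have hshift : ∑ m ∈ range (r + 1), coeff m (X * hitSeries q ^ (k + 1)) • φ (m + 1) =
      ∑ m ∈ range r, coeff m (hitSeries q ^ (k + 1)) • φ (m + 2) := by
    simp [sum_range_succ', coeff_succ_X_mul]
  rw [sum_range_succ', coeff_zero_eq_constantCoeff_apply, map_pow, constantCoeff_hitSeries hq,
    zero_pow k.succ_ne_zero, zero_smul, add_zero, ← hshift]
  simp only [hcoeff, add_smul, mul_smul, sum_add_distrib, smul_sum]

open Finset in
theorem payoff_eq (hq : q < 1) (r k a : ℕ) :
    payoff q φ ψ r k a = ∑ m ∈ range r, coeff m (hitSeries q ^ k) • φ (a + m) +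
      coeff r (overshootSeries q k) • φ (a + r) +
      coeff r (X * aliveSeries q k) • ψ (a + r - 1) := by
  induction r using Nat.strong_induction_on generalizing k a with
  | _ r ih =>
  match r, k with
  | 0, _ => simp [payoff, overshootSeries]
  | r + 1, 0 => simp [payoff, overshootSeries, aliveSeries_zero, coeff_one]
  | 1, _ + 1 =>
    simp [payoff, coeff_one_overshootSeries, coeff_succ_X_mul, constantCoeff_aliveSeries_succ hq,
      constantCoeff_hitSeries hq]
  | r + 2, k + 1 =>
    rw [payoff, ih _ (by lia), ih _ (by lia), ih _ (by lia), sum_coeff_hitSeries_pow_smul hq,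
      coeff_overshootSeries_add_two hq, coeff_X_mul_aliveSeries_add_two hq]
    simp only [show a + 1 + (r + 1) = a + (r + 2) by ring, show a + 2 + r = a + (r + 2) by ring,
      add_assoc a 1, add_assoc a 2, add_comm 1, add_comm 2]
    module

theorem coeff_overshootSeries_one (hq0 : 0 ≤ q) (hq : q < 1) (n : ℕ) :
    coeff (n + 1) (overshootSeries q 1) = tailMass (passageProb q) n - aliveProb q n := by
  have hconst : payoff q (fun _ => (1 : ℝ)) (fun _ => 1) (n + 1) 1 0 ∈ ({1} : Set ℝ) :=
    payoff_mem hq0 hq (convex_singleton 1) _ _ _ (fun _ _ _ => rfl) fun _ _ _ => rfl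
  rw [Set.mem_singleton_iff, payoff_eq hq, coeff_succ_X_mul, aliveSeries_one] at hconst
  simp only [smul_eq_mul, mul_one, pow_one] at hconst
  rw [tailMass, aliveProb]
  unfold passageProb
  linarith

open Finset in
theorem payoff_succ_one (hq0 : 0 ≤ q) (hq : q < 1) (n a : ℕ) :
    payoff q φ ψ (n + 1) 1 a = ∑ m ∈ range (n + 1), passageProb q m • φ (a + m) +
      (tailMass (passageProb q) n - aliveProb q n) • φ (a + (n + 1)) +
      aliveProb q n • ψ (a + n) := by
  rw [payoff_eq hq, coeff_overshootSeries_one hq0 hq, coeff_succ_X_mul, aliveSeries_one, pow_one]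
  rfl

theorem passageProb_nonneg (hq0 : 0 ≤ q) (hq : q < 1) (m : ℕ) : 0 ≤ passageProb q m := by
  have h : payoff q (fun b => if b = m then (1 : ℝ) else 0) (fun _ => 0) (m + 1) 1 0 ∈
      Set.Ici 0 :=
    payoff_mem hq0 hq (convex_Ici 0) _ _ _ (fun b _ _ => Set.mem_Ici.2 (by split_ifs <;> simp))
      fun _ _ _ => Set.mem_Ici.2 le_rfl
  simpa [payoff_succ_one hq0 hq] using h

theorem aliveProb_le_tailMass (hq0 : 0 ≤ q) (hq : q < 1) (n : ℕ) :
    aliveProb q n ≤ tailMass (passageProb q) n := by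
  have h : payoff q (fun b => if b = n + 1 then (1 : ℝ) else 0) (fun _ => 0) (n + 1) 1 0 ∈
      Set.Ici 0 :=
    payoff_mem hq0 hq (convex_Ici 0) _ _ _ (fun b _ _ => Set.mem_Ici.2 (by split_ifs <;> simp))
      fun _ _ _ => Set.mem_Ici.2 le_rfl
  rw [payoff_succ_one hq0 hq, Finset.sum_eq_zero fun m hm => by
    simp [(Finset.mem_range.1 hm).ne]] at h
  simpa using h

theorem payoff_indicator_pos (hq0 : 0 ≤ q) (hq : q < 1) (r k a : ℕ) :
    0 < payoff q (fun _ => (0 : ℝ)) (fun _ => 1) (r + 1) (k + 1) a := by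
  induction r generalizing k a with
  | zero => simp [payoff]
  | succ r ih =>
    have hnonneg (r k a : ℕ) : payoff q (fun _ => (0 : ℝ)) (fun _ => 1) r k a ∈ Set.Ici 0 :=
      payoff_mem hq0 hq (convex_Ici 0) _ _ _ (fun _ _ _ => Set.mem_Ici.2 le_rfl)
        fun _ _ _ => Set.mem_Ici.2 zero_le_one
    have hup := smul_pos (show 0 < (1 - q) / 2 by linarith) (ih (k + 1) (a + 1))
    have hdown := smul_nonneg (show 0 ≤ (1 - q) / 2 by linarith)
      (Set.mem_Ici.1 (hnonneg (r + 1) k (a + 1)))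
    have hflat := smul_nonneg hq0 (Set.mem_Ici.1 (hnonneg r (k + 1) (a + 2)))
    rw [payoff]
    linarith

theorem aliveProb_pos (hq0 : 0 ≤ q) (hq : q < 1) (n : ℕ) : 0 < aliveProb q n := by
  simpa [payoff_succ_one hq0 hq] using payoff_indicator_pos hq0 hq n 0 0

theorem tailMass_passageProb_succ (hq0 : 0 ≤ q) (hq : q < 1) (n : ℕ) :
    tailMass (passageProb q) (n + 1) = aliveProb q (n + 1) + q * aliveProb q n := by
  rw [← sub_eq_iff_eq_add', ← coeff_overshootSeries_one hq0 hq, overshootSeries, aliveSeries_one,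
    mul_assoc, map_add, coeff_C_mul, coeff_X_pow_mul', if_pos (by lia), coeff_one,
    if_neg (by lia), zero_add]
  rfl

theorem restartGenFun_mul_pow_eq_payoff (hq0 : 0 ≤ q) (hq : q < 1) (n : ℕ) {z : ℂ}
    (hz : ‖z‖ ≤ 1) (a : ℕ) : restartGenFun (passageProb q) (aliveProb q) n z * z ^ a =
      payoff q (fun b => restartGenFun (passageProb q) (aliveProb q) n z * z ^ b) (fun b => z ^ b)
        (n + 1) 1 a := by
  set G := restartGenFun (passageProb q) (aliveProb q) n z with hG
  have hne : 1 - failGenFun (passageProb q) (aliveProb q) n z ≠ 0 :=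
    one_sub_failGenFun_ne_zero (passageProb_nonneg hq0 hq) (aliveProb_pos hq0 hq n)
      (aliveProb_le_tailMass hq0 hq n) hz
  have hfix : failGenFun (passageProb q) (aliveProb q) n z * G + aliveProb q n * z ^ n = G := by
    rw [hG, restartGenFun]
    field_simp
    ring
  have hsum : ∑ m ∈ Finset.range (n + 1), passageProb q m • (G * z ^ (a + m)) =
      (∑ m ∈ Finset.range (n + 1), (passageProb q m : ℂ) * z ^ m) * (G * z ^ a) := by
    rw [Finset.sum_mul]
    refine Finset.sum_congr rfl fun m _ => ?_
    rw [Complex.real_smul, pow_add]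
    ring
  rw [payoff_succ_one hq0 hq, hsum, Complex.real_smul, Complex.real_smul]
  rw [failGenFun] at hfix
  linear_combination (-z ^ a) * hfix

theorem add_restartMean_eq_payoff (hq0 : 0 ≤ q) (hq : q < 1) (n a : ℕ) :
    a + restartMean (passageProb q) (aliveProb q) n =
      payoff q (fun b => b + restartMean (passageProb q) (aliveProb q) n) (fun b => (b : ℝ))
        (n + 1) 1 a := by
  set M := restartMean (passageProb q) (aliveProb q) n with hM
  have hfix : M * aliveProb q n = ∑ m ∈ Finset.range (n + 1), passageProb q m * m +
      (tailMass (passageProb q) n - aliveProb q n) * (n + 1) + aliveProb q n * n := by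
    rw [hM, restartMean, div_mul_cancel₀ _ (aliveProb_pos hq0 hq n).ne']
  have hsum : ∑ m ∈ Finset.range (n + 1), passageProb q m • (((a + m : ℕ) : ℝ) + M) =
      (a + M) * (1 - tailMass (passageProb q) n) +
        ∑ m ∈ Finset.range (n + 1), passageProb q m * m := by
    rw [tailMass, sub_sub_cancel, Finset.mul_sum, ← Finset.sum_add_distrib]
    refine Finset.sum_congr rfl fun m _ => ?_
    rw [smul_eq_mul, Nat.cast_add]
    ring
  rw [payoff_succ_one hq0 hq, hsum, smul_eq_mul, smul_eq_mul]
  push_cast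
  linear_combination hfix

theorem payoff_restartMean_mem_Icc (hq0 : 0 ≤ q) (hq : q < 1) (n r k a : ℕ) :
    payoff q (fun b => b + restartMean (passageProb q) (aliveProb q) n) (fun b => (b : ℝ)) r k a ∈
      Set.Icc (a : ℝ) (a + r + restartMean (passageProb q) (aliveProb q) n) := by
  have hM : 0 ≤ restartMean (passageProb q) (aliveProb q) n :=
    restartMean_nonneg (passageProb_nonneg hq0 hq) (aliveProb_pos hq0 hq n)
      (aliveProb_le_tailMass hq0 hq n)
  refine payoff_mem hq0 hq (convex_Icc _ _) r k a ?_ ?_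
  all_goals
    intro b hab hb
    have hab' : (a : ℝ) ≤ b := Nat.cast_le.2 hab
    have hb' : (b : ℝ) ≤ a + r := by exact_mod_cast hb
    constructor <;> linarith

theorem norm_payoff_pow_le (hq0 : 0 ≤ q) (hq : q < 1) (G : ℂ) {z : ℂ} (hz : ‖z‖ ≤ 1)
    (r k a : ℕ) : ‖payoff q (fun b => G * z ^ b) (fun b => z ^ b) r k a‖ ≤ 1 + ‖G‖ := by
  have hpow (b : ℕ) : ‖z ^ b‖ ≤ 1 := by
    rw [norm_pow]
    exact pow_le_one₀ (norm_nonneg z) hz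
  rw [← mem_closedBall_zero_iff]
  refine payoff_mem hq0 hq (convex_closedBall 0 _) r k a ?_ ?_
  · intro b _ _
    rw [mem_closedBall_zero_iff, norm_mul]
    exact (mul_le_of_le_one_right (norm_nonneg G) (hpow b)).trans
      (le_add_of_nonneg_left zero_le_one)
  · intro b _ _
    rw [mem_closedBall_zero_iff]
    exact (hpow b).trans (le_add_of_nonneg_right (norm_nonneg G))

end Payoff

end SchroderSampler

/-! ### The sampler -/

theorem integral_comp_eq_integral_sum_measureReal_smul {Ω A B E : Type*} [MeasurableSpace Ω]
    {μ : Measure Ω} [Fintype A] [MeasurableSpace A] [MeasurableSingletonClass A]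
    [MeasurableSpace B] [NormedAddCommGroup E] [NormedSpace ℝ E] {X : Ω → A} {Y : Ω → B}
    (hX : Measurable X) (hY : AEMeasurable Y μ) (hXY : IndepFun X Y μ) {g : A → B → E}
    (hg : ∀ a, StronglyMeasurable (g a)) (hint : ∀ a, Integrable (fun ω => g a (Y ω)) μ) :
    ∫ ω, g (X ω) (Y ω) ∂μ = ∫ ω, ∑ a, μ.real (X ⁻¹' {a}) • g a (Y ω) ∂μ := by
  classical
  have hfactor (a : A) : ∫ ω, (X ⁻¹' {a}).indicator (fun ω => g a (Y ω)) ω ∂μ =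
      ∫ ω, μ.real (X ⁻¹' {a}) • g a (Y ω) ∂μ := by
    have h := hXY.integral_fun_comp_smul_comp (f := Set.indicator {a} (1 : A → ℝ)) (g := g a)
      hX.aemeasurable hY (measurable_one.indicator (measurableSet_singleton a)).aestronglyMeasurable
      (hg a).aestronglyMeasurable
    rw [integral_smul, ← integral_indicator_one (hX (measurableSet_singleton a))]
    refine Eq.trans (integral_congr_ae (ae_of_all _ fun ω => ?_)) h
    by_cases hω : X ω = a <;> simp [Set.indicator, hω]
  have hsplit (ω : Ω) : g (X ω) (Y ω) =
      ∑ a, (X ⁻¹' {a}).indicator (fun ω => g a (Y ω)) ω := by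
    simp [Set.indicator_apply]
  simp_rw [hsplit]
  rw [integral_finsetSum _ fun a _ => (hint a).indicator (hX (measurableSet_singleton a)),
    integral_finsetSum _ fun a _ => (hint a).fun_smul _]
  exact Finset.sum_congr rfl fun a _ => hfactor a

namespace SchroderSampler

open SchroderStep

instance : Fintype SchroderStep :=
  ⟨⟨{up, down, flat}, by simp⟩, by rintro (_ | _ | _) <;> simp⟩

instance : DiscreteMeasurableSpace SchroderStep := ⟨fun _ => trivial⟩

theorem sum_schroderStep {E : Type*} [AddCommMonoid E] (g : SchroderStep → E) :
    ∑ s, g s = g up + g down + g flat := by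
  change (({up, down, flat} : Multiset SchroderStep).map g).sum = _
  simp [add_assoc]

theorem one_le_length (s : SchroderStep) : 1 ≤ s.length := by
  cases s <;> simp [SchroderStep.length]

/-- The law of a step that is flat with probability `q` and otherwise up or down with equal
probabilities; the steps of the sampler are the case `q = ρ ^ 2`. -/
noncomputable def stepWeight (q : ℝ) : SchroderStep → ℝ
  | up => (1 - q) / 2
  | down => (1 - q) / 2
  | flat => q

section StoppedChain

variable {n : ℕ} {x : ℕ → SchroderStep}

/-- One step of the sampler stopped when the target length is reached, on triples (total length of
the steps drawn, length and height of the path under construction). -/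
def stopStep (n : ℕ) (T : ℕ × ℕ × ℤ) (s : SchroderStep) : ℕ × ℕ × ℤ :=
  if T.2.1 = n then T else (T.1 + s.length, advance n T.2 s)

/-- The state after `k` draws of the sampler stopped when the target length is reached: total length
of the steps drawn, length and height of the path under construction. -/
def stopped (n : ℕ) (x : ℕ → SchroderStep) : ℕ → ℕ × ℕ × ℤ
  | 0 => (0, 0, 0)
  | k + 1 => stopStep n (stopped n x k) (x k)

theorem stopped_invariant (n : ℕ) (x : ℕ → SchroderStep) (k : ℕ) :
    (stopped n x k).2.1 ≤ n ∧ 0 ≤ (stopped n x k).2.2 := by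
  induction k with
  | zero => simp [stopped]
  | succ k ih =>
    rw [stopped, stopStep, advance]
    split_ifs with hn hreject
    · exact ih
    · simp
    · rw [not_or, not_lt, not_lt] at hreject
      exact hreject.symm

theorem stopped_eq_of_forall_ne {k : ℕ} (h : ∀ i < k, (state n x i).1 ≠ n) :
    stopped n x k = (∑ i ∈ Finset.range k, (x i).length, state n x k) := by
  induction k with
  | zero => rfl
  | succ k ih =>
    rw [stopped, ih fun i hi => h i (hi.trans k.lt_succ_self), stopStep,
      if_neg (h k k.lt_succ_self), Finset.sum_range_succ]
    rfl

theorem stopped_add_of_eq {k : ℕ} (h : (stopped n x k).2.1 = n) (i : ℕ) :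
    stopped n x (k + i) = stopped n x k := by
  induction i with
  | zero => rfl
  | succ i ih => rw [← add_assoc, stopped, ih, stopStep, if_pos h]

theorem stopped_of_halts (h : Halts n x) {k : ℕ} (hk : haltTime n x ≤ k) :
    (stopped n x k).1 = drawnLength n x ∧ (stopped n x k).2.1 = n := by
  have hhalt : (state n x (haltTime n x)).1 = n := Nat.sInf_mem h
  have hstopped : stopped n x (haltTime n x) = (drawnLength n x, state n x (haltTime n x)) :=
    stopped_eq_of_forall_ne fun i hi hi' =>
      Nat.notMem_of_lt_sInf (s := {k | (state n x k).1 = n}) hi hi'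
  obtain ⟨i, rfl⟩ := Nat.exists_eq_add_of_le hk
  rw [stopped_add_of_eq (by rwa [hstopped]), hstopped]
  exact ⟨rfl, hhalt⟩

theorem le_stopped_of_not_halts (h : ¬ Halts n x) (k : ℕ) : k ≤ (stopped n x k).1 := by
  rw [stopped_eq_of_forall_ne fun i _ hi => h ⟨i, hi⟩]
  simpa using Finset.card_nsmul_le_sum (Finset.range k) (fun i => (x i).length) 1
    fun i _ => one_le_length _

theorem stopped_fst_mono (n : ℕ) (x : ℕ → SchroderStep) : Monotone fun k => (stopped n x k).1 := by
  refine monotone_nat_of_le_succ fun k => ?_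
  rw [stopped, stopStep]
  split_ifs
  · exact le_rfl
  · exact Nat.le_add_right _ _

theorem stopped_fst_le_drawnLength (h : Halts n x) (k : ℕ) :
    (stopped n x k).1 ≤ drawnLength n x := by
  rw [← (stopped_of_halts h (le_max_left (haltTime n x) k)).1]
  exact stopped_fst_mono n x (le_max_right _ _)

theorem tendsto_stopped {E : Type*} [TopologicalSpace E] (h : Halts n x) (g : ℕ → E) :
    Tendsto (fun k => g (stopped n x k).1) atTop (𝓝 (g (drawnLength n x))) := by
  refine tendsto_const_nhds.congr' ?_
  filter_upwards [eventually_ge_atTop (haltTime n x)] with k hk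
  rw [(stopped_of_halts h hk).1]

theorem dependsOn_stopped (n k : ℕ) :
    DependsOn (fun x => stopped n x k) (Finset.range k : Set ℕ) := by
  intro x y hxy
  induction k with
  | zero => rfl
  | succ k ih =>
    simp only [Finset.coe_range, Set.mem_Iio] at ih hxy
    simp only [stopped]
    rw [ih fun i hi => hxy i (hi.trans k.lt_succ_self), hxy k k.lt_succ_self]

theorem exists_stopped_eq (n k : ℕ) : ∃ g : (Finset.range k → SchroderStep) → ℕ × ℕ × ℤ,
    ∀ x : ℕ → SchroderStep, stopped n x k = g fun i => x i := by
  obtain ⟨g, hg⟩ := dependsOn_iff_exists_comp.1 (dependsOn_stopped n k)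
  exact ⟨g, congrFun hg⟩

end StoppedChain

section StateValue

variable {E : Type*} [AddCommGroup E] [Module ℝ E] {q : ℝ} {φ ψ : ℕ → E}

/-- The reward expected by the stopped sampler in a given state: see `payoff`. -/
noncomputable def stateValue (q : ℝ) (φ ψ : ℕ → E) (n : ℕ) (T : ℕ × ℕ × ℤ) : E :=
  payoff q φ ψ (n + 1 - T.2.1) (T.2.2 + 1).toNat T.1

theorem stateValue_stopStep_of_ne {n : ℕ} (hφ : ∀ a, φ a = payoff q φ ψ (n + 1) 1 a) {a l : ℕ}
    {h : ℤ} (hl : l < n) (s : SchroderStep) : stateValue q φ ψ n (stopStep n (a, l, h) s) =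
      payoff q φ ψ (n + 1 - (l + s.length)) (h + s.rise + 1).toNat (a + s.length) := by
  rw [stopStep, if_neg hl.ne, advance]
  split_ifs with hreject
  · rw [stateValue]
    refine (hφ _).symm.trans ?_
    rcases hreject with hneg | hjump
    · rw [Int.toNat_of_nonpos (by lia), payoff_zero_right]
    · rw [Nat.sub_eq_zero_of_le hjump, payoff]
  · rfl

theorem sum_stepWeight_smul_stateValue {n : ℕ} (hφ : ∀ a, φ a = payoff q φ ψ (n + 1) 1 a)
    {T : ℕ × ℕ × ℤ} (hT : T.2.1 ≤ n ∧ 0 ≤ T.2.2) :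
    ∑ s, stepWeight q s • stateValue q φ ψ n (stopStep n T s) = stateValue q φ ψ n T := by
  obtain ⟨a, l, h⟩ := T
  obtain ⟨hl, hh⟩ := hT
  simp only at hl hh
  rw [sum_schroderStep]
  rcases hl.eq_or_lt with rfl | hl
  · simp only [stopStep, if_true, stepWeight]
    module
  obtain ⟨r, rfl⟩ : ∃ r, n = l + r + 1 := ⟨n - l - 1, by lia⟩
  lift h to ℕ using hh
  simp only [stateValue_stopStep_of_ne hφ hl, stepWeight, rise, SchroderStep.length]
  simp only [stateValue]
  rw [show l + r + 1 + 1 - (l + 1) = r + 1 by lia, show l + r + 1 + 1 - (l + 2) = r by lia,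
    show l + r + 1 + 1 - l = r + 2 by lia, show ((h : ℤ) + 1 + 1).toNat = h + 2 by lia,
    show ((h : ℤ) + -1 + 1).toNat = h by lia, show ((h : ℤ) + 0 + 1).toNat = h + 1 by lia,
    show ((h : ℤ) + 1).toNat = h + 1 by lia, payoff]

theorem stateValue_of_halts {n : ℕ} {x : ℕ → SchroderStep} (h : Halts n x) {k : ℕ}
    (hk : haltTime n x ≤ k) : stateValue q φ ψ n (stopped n x k) = ψ (drawnLength n x) := by
  obtain ⟨hdrawn, hlength⟩ := stopped_of_halts h hk
  rw [stateValue, hdrawn, hlength, Nat.add_sub_cancel_left,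
    Int.toNat_add (stopped_invariant n x k).2 zero_le_one, Int.toNat_one, payoff]

end StateValue

section RandomSteps

variable {Ω : Type*} [MeasurableSpace Ω] {μ : Measure Ω} {S : ℕ → Ω → SchroderStep} {q : ℝ}

/-- The random variables `S 0`, `S 1`, … are the steps drawn by the sampler: they are independent of
law `stepWeight q`. -/
structure IsStepSequence (q : ℝ) (S : ℕ → Ω → SchroderStep) (μ : Measure Ω) : Prop where
  measurable : ∀ i, Measurable (S i)
  indep : iIndepFun S μ
  measureReal_preimage : ∀ i s, μ.real (S i ⁻¹' {s}) = stepWeight q s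

theorem IsStepSequence.nonneg (hS : IsStepSequence q S μ) : 0 ≤ q :=
  measureReal_nonneg.trans_eq (hS.measureReal_preimage 0 flat)

theorem measurable_stopped (hS : ∀ i, Measurable (S i)) (n k : ℕ) :
    Measurable fun ω => stopped n (fun i => S i ω) k := by
  obtain ⟨g, hg⟩ := exists_stopped_eq n k
  simp_rw [hg]
  exact (Measurable.of_discrete (f := g)).comp (measurable_pi_lambda _ fun i => hS i)

theorem integrable_comp_stopped [IsFiniteMeasure μ] {E : Type*} [NormedAddCommGroup E]
    (hS : ∀ i, Measurable (S i)) (n k : ℕ) (g : ℕ × ℕ × ℤ → E) :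
    Integrable (fun ω => g (stopped n (fun i => S i ω) k)) μ := by
  obtain ⟨h, hh⟩ := exists_stopped_eq n k
  simp_rw [hh]
  have hmeas : Measurable fun ω (i : Finset.range k) => S i ω :=
    measurable_pi_lambda _ fun i => hS i
  exact (Integrable.of_finite (f := fun y => g (h y))).comp_measurable hmeas

theorem indepFun_stopped (hS : ∀ i, Measurable (S i)) (hindep : iIndepFun S μ) (n k : ℕ) :
    IndepFun (S k) (fun ω => stopped n (fun i => S i ω) k) μ := by
  obtain ⟨g, hg⟩ := exists_stopped_eq n k
  simp_rw [hg]
  exact (hindep.indepFun_finset {k} (Finset.range k) (by simp) hS).comp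
    (φ := fun y => y ⟨k, Finset.mem_singleton_self k⟩) (ψ := g) .of_discrete .of_discrete

variable [IsProbabilityMeasure μ]

theorem integral_stateValue {E : Type*} [NormedAddCommGroup E] [NormedSpace ℝ E]
    [CompleteSpace E] (hS : IsStepSequence q S μ) {n : ℕ} {φ ψ : ℕ → E}
    (hφ : ∀ a, φ a = payoff q φ ψ (n + 1) 1 a) (k : ℕ) :
    ∫ ω, stateValue q φ ψ n (stopped n (fun i => S i ω) k) ∂μ = φ 0 := by
  induction k with
  | zero => simpa [stopped, stateValue] using (hφ 0).symm
  | succ k ih =>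
    simp only [stopped]
    rw [integral_comp_eq_integral_sum_measureReal_smul (hS.measurable k)
      (measurable_stopped hS.measurable n k).aemeasurable
      (indepFun_stopped hS.measurable hS.indep n k)
      (g := fun s T => stateValue q φ ψ n (stopStep n T s)) (fun _ => .of_discrete)
      fun s => integrable_comp_stopped hS.measurable n k
        fun T => stateValue q φ ψ n (stopStep n T s)]
    simp_rw [hS.measureReal_preimage, sum_stepWeight_smul_stateValue hφ (stopped_invariant _ _ _)]
    exact ih

theorem integral_stopped_le (hS : IsStepSequence q S μ) (hq : q < 1) (n k : ℕ) :
    ∫ ω, ((stopped n (fun i => S i ω) k).1 : ℝ) ∂μ ≤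
      restartMean (passageProb q) (aliveProb q) n := by
  have h := integral_stateValue hS (add_restartMean_eq_payoff hS.nonneg hq n) k
  rw [Nat.cast_zero, zero_add] at h
  rw [← h]
  exact integral_mono (integrable_comp_stopped hS.measurable n k fun T => (T.1 : ℝ))
    (integrable_comp_stopped hS.measurable n k _)
    fun ω => (payoff_restartMean_mem_Icc hS.nonneg hq n _ _ _).1

theorem ae_halts (hS : IsStepSequence q S μ) (hq : q < 1) (n : ℕ) :
    ∀ᵐ ω ∂μ, Halts n (fun i => S i ω) := by
  rw [ae_iff]
  set N : Set Ω := {ω | ¬ Halts n (fun i => S i ω)}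
  have hmarkov (k : ℕ) : k * μ.real N ≤ restartMean (passageProb q) (aliveProb q) n := by
    calc k * μ.real N
        ≤ k * μ.real {ω | (k : ℝ) ≤ ((stopped n (fun i => S i ω) k).1 : ℝ)} := by
          refine mul_le_mul_of_nonneg_left (measureReal_mono fun ω hω => ?_) k.cast_nonneg
          exact_mod_cast le_stopped_of_not_halts hω k
      _ ≤ ∫ ω, ((stopped n (fun i => S i ω) k).1 : ℝ) ∂μ :=
          mul_meas_ge_le_integral_of_nonneg (ae_of_all _ fun ω => Nat.cast_nonneg _)
            (integrable_comp_stopped hS.measurable n k fun T => (T.1 : ℝ)) _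
      _ ≤ _ := integral_stopped_le hS hq n k
  rw [← measureReal_eq_zero_iff]
  by_contra hne
  have hpos : 0 < μ.real N := measureReal_nonneg.lt_of_ne' hne
  obtain ⟨k, hk⟩ := exists_nat_gt (restartMean (passageProb q) (aliveProb q) n / μ.real N)
  exact (hmarkov k).not_gt ((div_lt_iff₀ hpos).1 hk)

theorem aestronglyMeasurable_drawnLength (hS : IsStepSequence q S μ) (hq : q < 1) (n : ℕ) :
    AEStronglyMeasurable (fun ω => (drawnLength n (fun i => S i ω) : ℝ)) μ :=
  aestronglyMeasurable_of_tendsto_ae atTop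
    (fun k => (integrable_comp_stopped (μ := μ) hS.measurable n k
      fun T => (T.1 : ℝ)).aestronglyMeasurable)
    ((ae_halts hS hq n).mono fun _ hω => tendsto_stopped hω _)

theorem integrable_drawnLength (hS : IsStepSequence q S μ) (hq : q < 1) (n : ℕ) :
    Integrable (fun ω => (drawnLength n (fun i => S i ω) : ℝ)) μ := by
  have hint (k : ℕ) : Integrable (fun ω => ((stopped n (fun i => S i ω) k).1 : ℝ)) μ :=
    integrable_comp_stopped hS.measurable n k fun T => (T.1 : ℝ)
  refine ⟨aestronglyMeasurable_drawnLength hS hq n, ?_⟩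
  rw [hasFiniteIntegral_iff_ofReal (ae_of_all _ fun ω => Nat.cast_nonneg _)]
  have h := lintegral_tendsto_of_tendsto_of_monotone (μ := μ)
    (f := fun k ω => ENNReal.ofReal ((stopped n (fun i => S i ω) k).1 : ℝ))
    (F := fun ω => ENNReal.ofReal (drawnLength n (fun i => S i ω) : ℝ))
    (fun k => (hint k).aestronglyMeasurable.aemeasurable.ennreal_ofReal)
    (ae_of_all _ fun ω i j hij =>
      ENNReal.ofReal_le_ofReal (by exact_mod_cast stopped_fst_mono n _ hij))
    ((ae_halts hS hq n).mono fun _ hω =>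
      tendsto_stopped hω fun b => ENNReal.ofReal (b : ℝ))
  refine (le_of_tendsto' h fun k => ?_).trans_lt
    (ENNReal.ofReal_lt_top (r := restartMean (passageProb q) (aliveProb q) n))
  rw [← ofReal_integral_eq_lintegral_ofReal (hint k) (ae_of_all _ fun ω => Nat.cast_nonneg _)]
  exact ENNReal.ofReal_le_ofReal (integral_stopped_le hS hq n k)

theorem integral_comp_drawnLength {E : Type*} [NormedAddCommGroup E] [NormedSpace ℝ E]
    [CompleteSpace E] (hS : IsStepSequence q S μ) (hq : q < 1) {n : ℕ}
    {φ ψ : ℕ → E} (hφ : ∀ a, φ a = payoff q φ ψ (n + 1) 1 a) {bound : Ω → ℝ}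
    (hbound : Integrable bound μ)
    (hle : ∀ k, ∀ᵐ ω ∂μ, ‖stateValue q φ ψ n (stopped n (fun i => S i ω) k)‖ ≤ bound ω) :
    ∫ ω, ψ (drawnLength n (fun i => S i ω)) ∂μ = φ 0 := by
  refine tendsto_nhds_unique (tendsto_integral_of_dominated_convergence bound
    (fun k => (integrable_comp_stopped hS.measurable n k (stateValue q φ ψ n)).aestronglyMeasurable)
    hbound hle ?_) ?_
  · filter_upwards [ae_halts hS hq n] with ω hω
    refine tendsto_const_nhds.congr' ?_
    filter_upwards [eventually_ge_atTop (haltTime n fun i => S i ω)] with k hk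
    exact (stateValue_of_halts hω hk).symm
  · simp_rw [integral_stateValue hS hφ]
    exact tendsto_const_nhds

theorem integral_drawnLength (hS : IsStepSequence q S μ) (hq : q < 1) (n : ℕ) :
    ∫ ω, (drawnLength n (fun i => S i ω) : ℝ) ∂μ =
      restartMean (passageProb q) (aliveProb q) n := by
  set M := restartMean (passageProb q) (aliveProb q) n
  have h := integral_comp_drawnLength hS hq (add_restartMean_eq_payoff hS.nonneg hq n)
    (bound := fun ω => (drawnLength n (fun i => S i ω) : ℝ) + ((n + 1 : ℕ) + M))
    ((integrable_drawnLength hS hq n).add (integrable_const _)) fun k => by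
      filter_upwards [ae_halts hS hq n] with ω hω
      obtain ⟨hlow, hhigh⟩ := payoff_restartMean_mem_Icc hS.nonneg hq n
        (n + 1 - (stopped n (fun i => S i ω) k).2.1) ((stopped n (fun i => S i ω) k).2.2 + 1).toNat
        (stopped n (fun i => S i ω) k).1
      have hdrawn : ((stopped n (fun i => S i ω) k).1 : ℝ) ≤ drawnLength n fun i => S i ω :=
        Nat.cast_le.2 (stopped_fst_le_drawnLength hω k)
      have hleft : ((n + 1 - (stopped n (fun i => S i ω) k).2.1 : ℕ) : ℝ) ≤ (n + 1 : ℕ) :=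
        Nat.cast_le.2 (Nat.sub_le _ _)
      rw [stateValue, Real.norm_of_nonneg ((Nat.cast_nonneg _).trans hlow)]
      linarith
  simpa using h

theorem integral_pow_drawnLength (hS : IsStepSequence q S μ) (hq : q < 1) (n : ℕ) {z : ℂ}
    (hz : ‖z‖ ≤ 1) : ∫ ω, z ^ drawnLength n (fun i => S i ω) ∂μ =
      restartGenFun (passageProb q) (aliveProb q) n z := by
  have h := integral_comp_drawnLength hS hq
    (restartGenFun_mul_pow_eq_payoff hS.nonneg hq n hz) (integrable_const _)
    fun k => ae_of_all _ fun ω => norm_payoff_pow_le hS.nonneg hq _ hz _ _ _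
  simpa using h

theorem charFun_map_drawnLength_div (hS : IsStepSequence q S μ) (hq : q < 1) (n : ℕ)
    (t : ℝ) : charFun (μ.map fun ω => (drawnLength n (fun i => S i ω) : ℝ) / n) t =
      restartGenFun (passageProb q) (aliveProb q) n (Complex.exp ((t / n : ℝ) * Complex.I)) := by
  have hmeas :=
    (aestronglyMeasurable_drawnLength hS hq n).aemeasurable.div_const (n : ℝ)
  rw [charFun_apply_real, integral_map hmeas (by fun_prop),
    ← integral_pow_drawnLength hS hq n (Complex.norm_exp_ofReal_mul_I _).le]
  refine integral_congr_ae (ae_of_all _ fun ω => ?_)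
  simp only [← Complex.exp_nat_mul]
  push_cast
  ring_nf

end RandomSteps

end SchroderSampler

/-! ### Asymptotics of the passage and survival probabilities -/

theorem tsum_pos_of_even_add_odd {u : ℕ → ℝ} (hu : Summable u)
    (hpair : ∀ k, 0 ≤ u (2 * k) + u (2 * k + 1)) (h0 : 0 < u 0 + u 1) : 0 < ∑' n, u n := by
  have heven : Summable fun k => u (2 * k) :=
    hu.comp_injective (i := fun k => 2 * k) fun _ _ h => by simpa using h
  have hodd : Summable fun k => u (2 * k + 1) :=
    hu.comp_injective (i := fun k => 2 * k + 1) fun _ _ h => by simpa using h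
  rw [← tsum_even_add_odd heven hodd, ← heven.tsum_add hodd]
  exact (heven.add hodd).tsum_pos hpair 0 h0

namespace SchroderSampler

open PowerSeries

theorem tendsto_rpow_half_mul_coeff_sqrtSeries :
    Tendsto (fun n : ℕ => (n : ℝ) ^ (1 / 2 : ℝ) * coeff n sqrtSeries) atTop
      (𝓝 ((1 / 2 : ℝ) ^ (-(1 / 2) : ℝ) * √(1 / Real.pi))) := by
  simp_rw [coeff_sqrtSeries]
  refine tendsto_rpow_mul_comp tendsto_rpow_half_mul_centralBinom one_half_pos ?_
  have h := (tendsto_nat_floor_mul_div_atTop (R := ℝ) (a := 1 / 2) one_half_pos.le).comp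
    tendsto_natCast_atTop_atTop
  refine h.congr fun n => ?_
  rw [Function.comp_apply, one_div_mul_eq_div, Nat.floor_div_ofNat, Nat.floor_natCast]

theorem coeff_sqrtSeries_pos (n : ℕ) : 0 < coeff n sqrtSeries := by
  rw [coeff_sqrtSeries]
  have := (n / 2).centralBinom_pos
  positivity

theorem coeff_sqrtSeries_le_one (n : ℕ) : coeff n sqrtSeries ≤ 1 := by
  rw [coeff_sqrtSeries, div_le_one (by positivity), Nat.centralBinom_eq_two_mul_choose]
  have h : (2 : ℕ) ^ (2 * (n / 2)) = 4 ^ (n / 2) := by rw [pow_mul]; norm_num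
  exact_mod_cast (Nat.choose_le_two_pow _ _).trans_eq h

variable {q : ℝ}

theorem summable_rpow_half_mul_coeff_rescale_sqrtSeries (hq0 : 0 ≤ q) (hq : q < 1) :
    Summable fun n : ℕ => ((n : ℝ) + 1) ^ (1 / 2 : ℝ) * |coeff n (rescale (-q) sqrtSeries)| := by
  have hq' : ‖q‖ < 1 := by rwa [Real.norm_of_nonneg hq0]
  have hsum : Summable fun n : ℕ => ((n : ℝ) + 1) * q ^ n := by
    simpa [add_mul] using
      (summable_pow_mul_geometric_of_norm_lt_one 1 hq').add (summable_geometric_of_norm_lt_one hq')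
  refine hsum.of_nonneg_of_le (fun n => by positivity) fun n => ?_
  rw [coeff_rescale, abs_mul, abs_pow, abs_neg, abs_of_nonneg hq0,
    abs_of_pos (coeff_sqrtSeries_pos n)]
  refine mul_le_mul ?_ (mul_le_of_le_one_right (pow_nonneg hq0 n) (coeff_sqrtSeries_le_one n))
    (mul_nonneg (pow_nonneg hq0 n) (coeff_sqrtSeries_pos n).le) (by positivity)
  exact Real.rpow_le_self_of_one_le (by linarith [n.cast_nonneg (α := ℝ)]) (by norm_num)

theorem tsum_coeff_rescale_sqrtSeries_pos (hq0 : 0 ≤ q) (hq : q < 1) :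
    0 < ∑' n, coeff n (rescale (-q) sqrtSeries) := by
  have hsummable : Summable fun n => coeff n (rescale (-q) sqrtSeries) := by
    refine ((summable_rpow_half_mul_coeff_rescale_sqrtSeries hq0 hq).of_nonneg_of_le
      (fun n => abs_nonneg _) fun n => ?_).of_abs
    exact le_mul_of_one_le_left (abs_nonneg _)
      (Real.one_le_rpow (by linarith [n.cast_nonneg (α := ℝ)]) (by norm_num))
  refine tsum_pos_of_even_add_odd hsummable (fun k => ?_) ?_
  · have hpair : coeff (2 * k) (rescale (-q) sqrtSeries) +
        coeff (2 * k + 1) (rescale (-q) sqrtSeries) =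
          q ^ (2 * k) * (1 - q) * coeff (2 * k) sqrtSeries := by
      simp only [coeff_rescale, coeff_sqrtSeries, show (2 * k + 1) / 2 = 2 * k / 2 by lia,
        pow_succ, (even_two_mul k).neg_pow]
      ring
    rw [hpair]
    exact mul_nonneg (mul_nonneg (pow_nonneg hq0 _) (sub_nonneg.2 hq.le))
      (coeff_sqrtSeries_pos _).le
  · simpa [coeff_rescale, coeff_sqrtSeries] using hq

theorem exists_tendsto_rpow_half_mul_aliveProb (hq0 : 0 ≤ q) (hq : q < 1) : ∃ A > 0,
    Tendsto (fun n : ℕ => (n : ℝ) ^ (1 / 2 : ℝ) * aliveProb q n) atTop (𝓝 A) := by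
  have hratio := tendsto_rpow_mul_convolution one_half_pos.le
    tendsto_rpow_half_mul_coeff_sqrtSeries
    (summable_rpow_half_mul_coeff_rescale_sqrtSeries hq0 hq)
  simp_rw [← coeff_mul] at hratio
  have hshift := tendsto_rpow_mul_comp hratio one_pos (tendsto_natCast_add_div_atTop 1)
  rw [Real.one_rpow, one_mul] at hshift
  refine ⟨_, ?_, (hshift.const_mul (1 - q)⁻¹).congr fun n => ?_⟩
  · have := tsum_coeff_rescale_sqrtSeries_pos hq0 hq
    have := sub_pos.2 hq
    positivity
  · rw [aliveProb, prefixSeries, coeff_C_mul, coeff_mk, ratioSeries]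
    ring

theorem tendsto_rpow_half_mul_tailMass_passageProb (hq0 : 0 ≤ q) (hq : q < 1) {A : ℝ}
    (hA : Tendsto (fun n : ℕ => (n : ℝ) ^ (1 / 2 : ℝ) * aliveProb q n) atTop (𝓝 A)) :
    Tendsto (fun n : ℕ => (n : ℝ) ^ (1 / 2 : ℝ) * tailMass (passageProb q) n) atTop
      (𝓝 ((1 + q) * A)) := by
  have hshift := tendsto_rpow_mul_comp hA one_pos (tendsto_natCast_sub_div_atTop 1)
  have h := hA.add (hshift.const_mul q)
  rw [Real.one_rpow, one_mul, ← one_add_mul] at h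
  refine h.congr' ?_
  filter_upwards [eventually_gt_atTop 0] with n hn
  obtain ⟨m, rfl⟩ := Nat.exists_eq_succ_of_ne_zero hn.ne'
  rw [tailMass_passageProb_succ hq0 hq, Nat.succ_sub_one]
  ring

end SchroderSampler

theorem proposition2_general {Ω : Type*} [MeasurableSpace Ω] (μ : Measure Ω)
    [IsProbabilityMeasure μ] {q : ℝ} (hq : q < 1) (S : ℕ → Ω → SchroderStep)
    (hS : SchroderSampler.IsStepSequence q S μ) :
    (∀ n : ℕ, ∀ᵐ ω ∂μ, SchroderSampler.Halts n (fun i => S i ω)) ∧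
    (∃ L : ProbabilityMeasure ℝ,
      IsGeometricDarlingMandelbrot (1 / 2) (1 + q)⁻¹ (L : Measure ℝ) ∧
      TendstoInDistribution
        (fun (n : ℕ) (ω : Ω) =>
          (SchroderSampler.drawnLength n (fun i => S i ω) : ℝ) / (n : ℝ))
        atTop (id : ℝ → ℝ) (fun _ => μ) (L : Measure ℝ)) ∧
    (∀ n : ℕ, Integrable
      (fun ω => (SchroderSampler.drawnLength n (fun i => S i ω) : ℝ)) μ) ∧
    (fun n : ℕ => ∫ ω, (SchroderSampler.drawnLength n (fun i => S i ω) : ℝ) ∂μ)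
      ~[atTop] (fun n : ℕ => 2 * (1 + q) * (n : ℝ)) := by
  obtain ⟨A, hA0, hA⟩ := SchroderSampler.exists_tendsto_rpow_half_mul_aliveProb hS.nonneg hq
  have htail := SchroderSampler.tendsto_rpow_half_mul_tailMass_passageProb hS.nonneg hq hA
  have hq1 : 0 < 1 + q := by linarith [hS.nonneg]
  have hp : 0 < (1 + q)⁻¹ := inv_pos.2 hq1
  have hp1 : (1 + q)⁻¹ ≤ 1 := inv_le_one_of_one_le₀ (by linarith [hS.nonneg])
  have hc : (1 + q) * A ≠ 0 := (mul_pos hq1 hA0).ne'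
  rw [← inv_mul_cancel_left₀ hq1.ne' A] at hA
  refine ⟨SchroderSampler.ae_halts hS hq, ?_, SchroderSampler.integrable_drawnLength hS hq, ?_⟩
  · obtain ⟨L, hL⟩ := exists_isGeometricDarlingMandelbrot one_half_pos one_half_lt_one hp hp1
    refine ⟨L, hL, fun n => (SchroderSampler.aestronglyMeasurable_drawnLength hS hq
      n).aemeasurable.div_const _, aemeasurable_id, ?_⟩
    refine ProbabilityMeasure.tendsto_iff_tendsto_charFun.2 fun t => ?_
    simp only [ProbabilityMeasure.coe_mk, Measure.map_id,
      SchroderSampler.charFun_map_drawnLength_div hS hq]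
    exact tendsto_restartGenFun one_half_pos.le one_half_lt_one hp hp1 hc htail hA hL t
  · simp_rw [SchroderSampler.integral_drawnLength hS hq]
    convert! isEquivalent_restartMean one_half_pos.le one_half_lt_one hp.ne' hc htail hA using 3
    rw [mul_inv, inv_inv]
    norm_num
    ring

namespace SchroderStep

theorem rho_sq : rho ^ 2 = 3 - 2 * √2 := by
  rw [rho, sub_sq, Real.sq_sqrt zero_le_two]
  ring

theorem rho_sq_lt_one : rho ^ 2 < 1 := by
  rw [rho_sq]
  linarith [Real.one_lt_sqrt_two]

theorem weight_eq_stepWeight (s : SchroderStep) :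
    s.weight = SchroderSampler.stepWeight (rho ^ 2) s := by
  cases s
  case flat => rfl
  all_goals
    rw [weight, SchroderSampler.stepWeight, rho_sq, rho]
    ring

theorem inv_one_add_rho_sq : (1 + rho ^ 2)⁻¹ = (2 + √2) / 4 := by
  refine inv_eq_of_mul_eq_one_right ?_
  rw [rho_sq]
  linear_combination (-1 / 2 : ℝ) * Real.sq_sqrt zero_le_two

theorem two_mul_one_add_rho_sq : 2 * (1 + rho ^ 2) = 8 - 4 * √2 := by
  rw [rho_sq]
  ring

end SchroderStep

theorem proposition2 {Ω : Type*} [MeasurableSpace Ω] (μ : Measure Ω) [IsProbabilityMeasure μ]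
    (S : ℕ → Ω → SchroderStep) (hS : ∀ i, Measurable (S i)) (hindep : iIndepFun S μ)
    (hlaw : ∀ i s, μ.real (S i ⁻¹' {s}) = s.weight) :
    (∀ n : ℕ, ∀ᵐ ω ∂μ, SchroderSampler.Halts n (fun i => S i ω)) ∧
    (∃ L : ProbabilityMeasure ℝ,
      IsGeometricDarlingMandelbrot (1 / 2) ((2 + √2) / 4) (L : Measure ℝ) ∧
      TendstoInDistribution
        (fun (n : ℕ) (ω : Ω) =>
          (SchroderSampler.drawnLength n (fun i => S i ω) : ℝ) / (n : ℝ))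
        atTop (id : ℝ → ℝ) (fun _ => μ) (L : Measure ℝ)) ∧
    (∀ n : ℕ, Integrable
      (fun ω => (SchroderSampler.drawnLength n (fun i => S i ω) : ℝ)) μ) ∧
    (fun n : ℕ => ∫ ω, (SchroderSampler.drawnLength n (fun i => S i ω) : ℝ) ∂μ)
      ~[atTop] (fun n : ℕ => (8 - 4 * √2) * (n : ℝ)) := by
  rw [← SchroderStep.inv_one_add_rho_sq, ← SchroderStep.two_mul_one_add_rho_sq]
  exact proposition2_general μ SchroderStep.rho_sq_lt_one S
    ⟨hS, hindep, fun i s => (hlaw i s).trans s.weight_eq_stepWeight⟩
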